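/- Let $K/\mathbb{Q}$ be a Galois number field of degree $k\ge 3$ and let $\{1=\omega_1,\dots,\omega_k\}$ be an integral basis of its ring of integers $\mathcal{O}_K$. For $\mathbf{v}=(v_1,\dots,v_{k-1})\in\mathbb{Z}^{k-1}$ put $N(\mathbf{v})=|N_{K/\mathbb{Q}}(v_1\omega_1+\dots+v_{k-1}\omega_{k-1})|$, and let $\|\mathbf{v}\|$ be the Euclidean norm. Let $C>0$ and $A$ be real constants, and let $F:\mathbb{N}\to\mathbb{R}$ be a multiplicative function such that $0\le F(p^\alpha)\le A\,\alpha^{C}$ for all primes $p$ and all integers $\alpha\ge 1$, such that $F(p)=k$ for every prime $p$ lying below a prime ideal of $\mathcal{O}_K$ of degree one, and such that $F(p)=0$ for all other primes $p$. Then for all real $V\ge 2$ $$\sum_{\substack{0\ne \mathbf{v}\in\mathbb{Z}^{k-1}\\ \|\mathbf{v}\|\le V}} F(N(\mathbf{v}))\ll V^{k-1}(\log V)^{k-1},$$ where the implied constant depends only on $K$, the basis $\omega_1,\dots,\omega_k$, $C$ and $A$. -/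

import Mathlib

open NumberField

/-- `p` lies below a prime ideal of degree one of the ring of integers of `K`, that is, below a
prime ideal whose residue field is `ℤ/p`. -/
def LiesBelowDegreeOne (K : Type*) [Field K] [NumberField K] (p : ℕ) : Prop :=
  ∃ P : Ideal (𝓞 K), P.IsPrime ∧ P.LiesOver (Ideal.span {(p : ℤ)}) ∧
    P.inertiaDeg ℤ = 1

/-- The algebraic integer `v₁ ω₁ + ⋯ + v_{k-1} ω_{k-1}` attached to an integral vector of length
`k - 1`, which is read as a vector of length `k` with vanishing last coordinate. -/
noncomputable def toInteger {K : Type*} [Field K] {k : ℕ}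
    (ω : Module.Basis (Fin k) ℤ (𝓞 K)) (v : Fin (k - 1) → ℤ) : 𝓞 K :=
  ∑ i, v i • ω (Fin.castLE (Nat.sub_le k 1) i)

/-- The absolute value of the incomplete norm form at `v`, equivalently the norm of the principal
ideal generated by the algebraic integer attached to `v`. -/
noncomputable def incompleteNorm {K : Type*} [Field K] {k : ℕ}
    (ω : Module.Basis (Fin k) ℤ (𝓞 K)) (v : Fin (k - 1) → ℤ) : ℕ :=
  (Algebra.norm ℤ (toInteger ω v)).natAbs

/-- The Euclidean norm of an integral vector. -/
noncomputable def euclNorm {m : ℕ} (v : Fin m → ℤ) : ℝ :=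
  ‖WithLp.toLp 2 (fun i => (v i : ℝ))‖

theorem finite_nonzero_euclNorm_le (m : ℕ) (V : ℝ) :
    {v : Fin m → ℤ | v ≠ 0 ∧ euclNorm v ≤ V}.Finite := by
  refine (Set.finite_Icc (fun _ : Fin m => -⌊V⌋) (fun _ => ⌊V⌋)).subset ?_
  rintro v ⟨-, hv⟩
  have h : ∀ i, |v i| ≤ ⌊V⌋ := fun i => by
    have h1 := PiLp.norm_apply_le (WithLp.toLp 2 (fun i => (v i : ℝ))) i
    rw [Int.le_floor]
    push_cast
    exact h1.trans hv
  exact ⟨fun i => (abs_le.mp (h i)).1, fun i => (abs_le.mp (h i)).2⟩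

/-- The finite set of nonzero integral vectors of Euclidean norm at most `V`. -/
noncomputable def nonzeroBall (m : ℕ) (V : ℝ) : Finset (Fin m → ℤ) :=
  (finite_nonzero_euclNorm_le m V).toFinset

theorem mem_nonzeroBall {m : ℕ} {V : ℝ} {v : Fin m → ℤ} :
    v ∈ nonzeroBall m V ↔ v ≠ 0 ∧ euclNorm v ≤ V := by
  simp [nonzeroBall]

/-! It suffices to bound the sum of a multiplicative G ≥ F with G(p) = k at primes below a
degree-one prime, G(p) = 1 at the other primes, and polynomial growth in α at p^α. The obstacle is
that a norm n can be as large as V^κ, while the vectors with d ∣ N(v) are controlled by residue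
classes only for d ≤ V. As in the method of Wolke and Nair, write n = ab, where a ≤ V takes the
prime factors in increasing order until the next one, q, would push it beyond V
(`exists_dvd_le_and_primes_split`). If q is about V^(1/s), then b has O(s) prime factors and G(n) ≤
G(a) exp(O(s)). For s ≥ 2, a is at least √V and has no prime factor above V^(1/s), so Rankin's
weight a^β with β = cs/log V pays for exp(O(s)) with e^(-s) to spare. If q is bounded, G(n) ≪ n^ε is
enough (`majorant_le_sum_smoothDivisorSum`). What remains are sums over divisors d ≤ V weighted by
the density δ(d) of d ∣ N(v), and an Euler product bounds them by exp(∑ (G(p) - 1) δ(p)) up to a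
constant (`exists_sum_smoothNumbers_le`).

For the densities, N(v) is up to sign a product of k conjugate linear forms. Since ω₁ = 1, moving
the first coordinate moves every conjugate by the same integer, and packing translates
(`density_le_of_packing`) gives δ(p) ≤ k/p, together with geometric decay of δ(p^α) in α. The bound
δ(p^α) ≪ p^(-2) for α ≥ 2 also needs two conjugate forms to be independent modulo almost every
prime; this is where k ≥ 3 enters.

Finally G(p) - 1 is k - 1 below degree-one primes and 0 elsewhere, so the exponent is at most (k -
1) ∑ k/p over the former. That sum is at most log log V + O(1), because ζ_K has a simple pole at 1
and almost all of these p have k primes of norm p above them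
(`exists_exp_sum_liesBelowDegreeOne_le`). -/

namespace NormFormSum

/-! ### Densities of residue classes. -/

/-- The residue classes modulo `d` that contain an integral vector with the property `Q`. -/
def residueSet {m : ℕ} (d : ℕ) (Q : (Fin m → ℤ) → Prop) : Set (Fin m → ZMod d) :=
  {x | ∃ v : Fin m → ℤ, (∀ i, (v i : ZMod d) = x i) ∧ Q v}

/-- The proportion of the residue classes modulo `d` that contain an integral vector with the
property `Q`. -/
noncomputable def density {m : ℕ} (d : ℕ) (Q : (Fin m → ℤ) → Prop) : ℝ :=
  (residueSet d Q).ncard / (d : ℝ) ^ m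

theorem density_nonneg {m : ℕ} (d : ℕ) (Q : (Fin m → ℤ) → Prop) : 0 ≤ density d Q := by
  unfold density; positivity

theorem card_residues {m : ℕ} (d : ℕ) [NeZero d] : Fintype.card (Fin m → ZMod d) = d ^ m := by
  simp [ZMod.card]

theorem density_mono {m d : ℕ} [NeZero d] {Q R : (Fin m → ℤ) → Prop} (h : ∀ v, Q v → R v) :
    density d Q ≤ density d R := by
  unfold density
  gcongr
  · exact Set.toFinite _
  · rintro x ⟨v, hv, hQ⟩
    exact ⟨v, hv, h v hQ⟩

theorem density_le_sum {m d : ℕ} [NeZero d] {Q : (Fin m → ℤ) → Prop} {σ : Type*} (S : Finset σ)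
    (R : σ → (Fin m → ℤ) → Prop) (h : ∀ v, Q v → ∃ s ∈ S, R s v) :
    density d Q ≤ ∑ s ∈ S, density d (R s) := by
  unfold density
  rw [← Finset.sum_div]
  gcongr
  have h1 : residueSet d Q ⊆ ⋃ s ∈ S, residueSet d (R s) := by
    rintro x ⟨v, hv, hQ⟩
    obtain ⟨s, hs, hR⟩ := h v hQ
    simp only [Set.mem_iUnion]
    exact ⟨s, hs, v, hv, hR⟩
  have h2 := (Set.ncard_le_ncard h1 (Set.toFinite _)).trans
    (Finset.set_ncard_biUnion_le S fun s => residueSet d (R s))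
  exact_mod_cast h2

/-- The hypothesis says that the translates of the admissible classes by the `t a` are pairwise
disjoint modulo `d`, so together they fit into `d ^ m` classes. The local density bounds below come
from exhibiting such translates. -/
theorem density_le_of_packing {m d : ℕ} [NeZero d] {Q : (Fin m → ℤ) → Prop} {τ : Type*}
    [Fintype τ] [Nonempty τ] (t : τ → Fin m → ℤ)
    (h : ∀ v w a b, Q v → Q w → (∀ i, (d : ℤ) ∣ (v i + t a i) - (w i + t b i)) → a = b) :
    density d Q ≤ 1 / Fintype.card τ := by
  have hd : (0 : ℝ) < (d : ℝ) ^ m := by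
    have := NeZero.pos d
    positivity
  have hτ : (0 : ℝ) < Fintype.card τ := by exact_mod_cast Fintype.card_pos
  let f : residueSet d Q × τ → (Fin m → ZMod d) := fun x i => x.1.1 i + (t x.2 i : ZMod d)
  have hf : Function.Injective f := by
    rintro ⟨⟨x, v, hv, hQv⟩, a⟩ ⟨⟨y, w, hw, hQw⟩, b⟩ hxy
    have h1 : ∀ i, x i + (t a i : ZMod d) = y i + (t b i : ZMod d) := fun i => congrFun hxy i
    have hab : a = b := by
      refine h v w a b hQv hQw fun i => ?_
      rw [← ZMod.intCast_zmod_eq_zero_iff_dvd]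
      push_cast
      rw [hv i, hw i, h1 i, sub_self]
    subst hab
    have : x = y := funext fun i => add_right_cancel (h1 i)
    subst this
    rfl
  have h2 : (residueSet d Q).ncard * Fintype.card τ ≤ d ^ m := by
    rw [← card_residues d, ← Nat.card_coe_set_eq, ← Nat.card_eq_fintype_card (α := τ),
      ← Nat.card_prod, ← Nat.card_eq_fintype_card]
    exact Nat.card_le_card_of_injective f hf
  unfold density
  rw [div_le_div_iff₀ hd hτ, one_mul]
  exact_mod_cast h2

/-- Divisibility of the values of `N` by `d` depends only on the argument modulo `d`. -/
def DvdPeriodic {m : ℕ} (N : (Fin m → ℤ) → ℕ) : Prop :=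
  ∀ (d : ℕ) (v w : Fin m → ℤ), (∀ i, (d : ℤ) ∣ v i - w i) → d ∣ N v → d ∣ N w

/-- The proportion of the residue classes modulo `d` on which `N` is divisible by `d`. -/
noncomputable def dvdDensity {m : ℕ} (N : (Fin m → ℤ) → ℕ) (d : ℕ) : ℝ :=
  density d fun v => d ∣ N v

theorem dvdDensity_nonneg {m : ℕ} (N : (Fin m → ℤ) → ℕ) (d : ℕ) : 0 ≤ dvdDensity N d :=
  density_nonneg _ _

theorem DvdPeriodic.of_cast_eq {m : ℕ} {N : (Fin m → ℤ) → ℕ} (hN : DvdPeriodic N) {d : ℕ}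
    {v w : Fin m → ℤ} (h : ∀ i, (v i : ZMod d) = (w i : ZMod d)) (hv : d ∣ N v) : d ∣ N w := by
  refine hN d v w (fun i => ?_) hv
  rw [← ZMod.intCast_zmod_eq_zero_iff_dvd]
  push_cast
  rw [h i, sub_self]

theorem dvdDensity_one {m : ℕ} (N : (Fin m → ℤ) → ℕ) : dvdDensity N 1 = 1 := by
  have : residueSet (m := m) 1 (fun v => 1 ∣ N v) = Set.univ := by
    ext x
    simp only [Set.mem_univ, iff_true]
    exact ⟨fun _ => 0, fun i => Subsingleton.elim _ _, one_dvd _⟩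
  rw [dvdDensity, density, this]
  simp [Set.ncard_univ]

/-- Chinese remainder theorem; periodicity carries the two divisibilities over to a common lift. -/
theorem dvdDensity_mul {m : ℕ} {N : (Fin m → ℤ) → ℕ} (hN : DvdPeriodic N) {a b : ℕ}
    (hab : a.Coprime b) : dvdDensity N (a * b) = dvdDensity N a * dvdDensity N b := by
  have key : (residueSet (a * b) fun v => a * b ∣ N v).ncard =
      (residueSet a fun v => a ∣ N v).ncard * (residueSet b fun v => b ∣ N v).ncard := by
    rw [← Set.ncard_prod]
    let e := ZMod.chineseRemainder hab
    have he : ∀ z : ℤ, e (z : ZMod (a * b)) = ((z : ZMod a), (z : ZMod b)) := fun z => by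
      rw [map_intCast]; rfl
    refine Set.ncard_congr (fun x _ => (fun i => (e (x i)).1, fun i => (e (x i)).2)) ?_ ?_ ?_
    · rintro x ⟨v, hv, hd⟩
      refine ⟨⟨v, fun i => ?_, dvd_of_mul_right_dvd hd⟩, ⟨v, fun i => ?_, dvd_of_mul_left_dvd hd⟩⟩
      · simp [← hv i, he]
      · simp [← hv i, he]
    · intro x y _ _ hxy
      ext i
      apply e.injective
      exact Prod.ext (congrFun (congrArg Prod.fst hxy) i) (congrFun (congrArg Prod.snd hxy) i)
    · rintro ⟨x, y⟩ ⟨⟨v, hv, hdv⟩, ⟨w, hw, hdw⟩⟩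
      have hu : ∀ i, ∃ u : ℤ, (u : ZMod (a * b)) = e.symm (x i, y i) := fun i =>
        ZMod.intCast_surjective _
      choose u hu using hu
      have hu' : ∀ i, ((u i : ZMod a), (u i : ZMod b)) = (x i, y i) := fun i => by
        rw [← he, hu, RingEquiv.apply_symm_apply]
      refine ⟨fun i => e.symm (x i, y i), ⟨u, hu, ?_⟩, ?_⟩
      · refine hab.mul_dvd_of_dvd_of_dvd ?_ ?_
        · exact hN.of_cast_eq (fun i => (hv i).trans (congrArg Prod.fst (hu' i)).symm) hdv
        · exact hN.of_cast_eq (fun i => (hw i).trans (congrArg Prod.snd (hu' i)).symm) hdw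
      · simp
  unfold dvdDensity density
  rw [key]
  push_cast
  rw [mul_pow, mul_div_mul_comm]

-- A vector is determined by its residues and its quotients modulo `d`. Each quotient takes at most
-- 2V/d + 2 values, and d ≤ V turns this into 4V/d.
open Classical in
theorem card_dvd_le {m : ℕ} (N : (Fin m → ℤ) → ℕ) {d : ℕ} (hd : 0 < d) {V : ℝ} (hV : (d : ℝ) ≤ V) :
    (((nonzeroBall m V).filter fun v => d ∣ N v).card : ℝ) ≤ (4 * V) ^ m * dvdDensity N d := by
  have : NeZero d := ⟨hd.ne'⟩
  have hdR : (0 : ℝ) < d := by exact_mod_cast hd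
  have hdZ : (0 : ℤ) < d := by exact_mod_cast hd
  set M : ℤ := ⌊V⌋ with hM
  have hM0 : 0 ≤ M := Int.floor_nonneg.mpr (hdR.le.trans hV)
  let I : Finset ℤ := Finset.Icc ((-M) / d) (M / d)
  let R : Finset (Fin m → ZMod d) := (Set.toFinite (residueSet d fun v => d ∣ N v)).toFinset
  have hRcard : R.card = (residueSet d fun v => d ∣ N v).ncard :=
    (Set.ncard_eq_toFinset_card _ _).symm
  have hmap : ((nonzeroBall m V).filter fun v => d ∣ N v).card ≤
      (R ×ˢ Fintype.piFinset fun _ : Fin m => I).card := by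
    refine Finset.card_le_card_of_injOn (fun v => (fun i => (v i : ZMod d), fun i => v i / d))
      ?_ ?_
    · intro v hv
      rw [Finset.mem_coe, Finset.mem_filter, mem_nonzeroBall] at hv
      obtain ⟨⟨-, hv⟩, hdv⟩ := hv
      have hvi : ∀ i, |v i| ≤ M := fun i => by
        rw [hM, Int.le_floor]
        push_cast
        exact (PiLp.norm_apply_le (WithLp.toLp 2 (fun i => (v i : ℝ))) i).trans hv
      simp only [Finset.coe_product, Set.mem_prod, Finset.mem_coe, Fintype.mem_piFinset, R, I,
        Set.Finite.mem_toFinset, Finset.mem_Icc]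
      refine ⟨⟨v, fun i => rfl, hdv⟩, fun i => ⟨?_, ?_⟩⟩
      · exact Int.ediv_le_ediv hdZ (abs_le.mp (hvi i)).1
      · exact Int.ediv_le_ediv hdZ (abs_le.mp (hvi i)).2
    · intro v _ w _ h
      ext i
      have h1 : (v i : ZMod d) = (w i : ZMod d) := congrFun (congrArg Prod.fst h) i
      have h2 : v i / d = w i / d := congrFun (congrArg Prod.snd h) i
      have h3 := (ZMod.intCast_eq_intCast_iff' _ _ _).mp h1
      rw [← Int.mul_ediv_add_emod (v i) d, ← Int.mul_ediv_add_emod (w i) d, h2, h3]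
  have hI : (I.card : ℝ) ≤ 4 * V / d := by
    have h1 : (I.card : ℤ) = M / d + 1 - (-M) / d := by
      simp only [I, Int.card_Icc]
      refine Int.toNat_of_nonneg ?_
      have : (-M) / (d : ℤ) ≤ M / d := Int.ediv_le_ediv hdZ (by omega)
      omega
    have h2 : (d : ℤ) * (I.card : ℤ) ≤ 2 * M + 2 * d := by
      rw [h1]
      have e1 := Int.mul_ediv_add_emod M d
      have e2 := Int.mul_ediv_add_emod (-M) d
      have e3 := Int.emod_nonneg M hdZ.ne'
      have e4 := Int.emod_lt_of_pos (-M) hdZ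
      have : (d : ℤ) * (M / d + 1 - -M / d) = d * (M / d) + d - d * (-M / d) := by ring
      rw [this]
      omega
    have h3 : (d : ℝ) * (I.card : ℝ) ≤ 2 * M + 2 * d := by exact_mod_cast h2
    have h4 : (M : ℝ) ≤ V := Int.floor_le V
    rw [le_div_iff₀ hdR]
    nlinarith
  calc (((nonzeroBall m V).filter fun v => d ∣ N v).card : ℝ)
      ≤ ((R ×ˢ Fintype.piFinset fun _ : Fin m => I).card : ℝ) := by exact_mod_cast hmap
    _ = (residueSet d fun v => d ∣ N v).ncard * (I.card : ℝ) ^ m := by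
        rw [Finset.card_product, hRcard]
        simp
    _ ≤ (residueSet d fun v => d ∣ N v).ncard * (4 * V / d) ^ m := by gcongr
    _ = (4 * V) ^ m * dvdDensity N d := by
        unfold dvdDensity density
        rw [div_pow]
        ring

end NormFormSum

/-! ### Multiplicative majorants and their divisor weights. -/

namespace NormFormSum

open ArithmeticFunction

/-- The multiplicative function with value `g p α` at the prime power `p ^ α`. -/
noncomputable def ofPrimePowers (g : ℕ → ℕ → ℝ) : ArithmeticFunction ℝ :=
  ⟨fun n => if n = 0 then 0 else n.factorization.prod g, by simp⟩

theorem ofPrimePowers_apply (g : ℕ → ℕ → ℝ) {n : ℕ} (hn : n ≠ 0) :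
    ofPrimePowers g n = n.factorization.prod g := by
  simp [ofPrimePowers, hn]

theorem ofPrimePowers_isMultiplicative (g : ℕ → ℕ → ℝ) :
    (ofPrimePowers g).IsMultiplicative := by
  rw [IsMultiplicative.iff_ne_zero]
  refine ⟨by simp [ofPrimePowers], fun {a b} ha hb hab => ?_⟩
  rw [ofPrimePowers_apply g (mul_ne_zero ha hb), ofPrimePowers_apply g ha,
    ofPrimePowers_apply g hb, Nat.factorization_mul_of_coprime hab,
    Finsupp.prod_add_index_of_disjoint]
  simpa using hab.disjoint_primeFactors

theorem ofPrimePowers_prime_pow {g : ℕ → ℕ → ℝ} (hg : ∀ p, g p 0 = 1) {p : ℕ} (hp : p.Prime)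
    (α : ℕ) : ofPrimePowers g (p ^ α) = g p α := by
  rw [ofPrimePowers_apply g (pow_ne_zero _ hp.ne_zero), hp.factorization_pow,
    Finsupp.prod_single_index (hg p)]

theorem IsMultiplicative.nonneg_of_prime_pow {f : ArithmeticFunction ℝ} (hf : f.IsMultiplicative)
    (h : ∀ p α : ℕ, p.Prime → 1 ≤ α → 0 ≤ f (p ^ α)) (n : ℕ) : 0 ≤ f n := by
  rcases eq_or_ne n 0 with rfl | hn
  · simp
  rw [hf.multiplicative_factorization f hn]
  refine Finset.prod_nonneg fun p hp => ?_
  have := Nat.prime_of_mem_primeFactors hp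
  exact h p _ this (this.factorization_pos_of_dvd hn (Nat.dvd_of_mem_primeFactors hp))

theorem IsMultiplicative.le_of_prime_pow {f g : ArithmeticFunction ℝ} (hf : f.IsMultiplicative)
    (hg : g.IsMultiplicative) (h0 : ∀ p α : ℕ, p.Prime → 1 ≤ α → 0 ≤ f (p ^ α))
    (h : ∀ p α : ℕ, p.Prime → 1 ≤ α → f (p ^ α) ≤ g (p ^ α)) (n : ℕ) : f n ≤ g n := by
  rcases eq_or_ne n 0 with rfl | hn
  · simp
  rw [hf.multiplicative_factorization f hn, hg.multiplicative_factorization g hn]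
  refine Finset.prod_le_prod (fun p hp => ?_) fun p hp => ?_
  all_goals
    have h1 := Nat.prime_of_mem_primeFactors hp
    have h2 := h1.factorization_pos_of_dvd hn (Nat.dvd_of_mem_primeFactors hp)
  · exact h0 p _ h1 h2
  · exact h p _ h1 h2

/-- A multiplicative function with value `w p` at the prime `p` and polynomial growth in the
exponent at higher prime powers. -/
noncomputable def majorant (w : ℕ → ℝ) (J : ℕ) : ArithmeticFunction ℝ :=
  ofPrimePowers fun p α => if α = 0 then 1 else if α = 1 then w p else ((α : ℝ) + 1) ^ J

/-- A nonnegative multiplicative function whose divisor sum bounds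
`majorant w J n * n ^ β` from above. -/
noncomputable def divisorWeight (w : ℕ → ℝ) (J : ℕ) (β : ℝ) : ArithmeticFunction ℝ :=
  ofPrimePowers fun p α => if α = 0 then 1 else if α = 1 then w p * (p : ℝ) ^ β - 1 else
    ((α : ℝ) + 1) ^ J * (p : ℝ) ^ (α * β)

section

variable {w : ℕ → ℝ} {J : ℕ} {β : ℝ}

theorem majorant_isMultiplicative : (majorant w J).IsMultiplicative :=
  ofPrimePowers_isMultiplicative _

theorem divisorWeight_isMultiplicative : (divisorWeight w J β).IsMultiplicative :=
  ofPrimePowers_isMultiplicative _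

theorem majorant_prime_pow {p : ℕ} (hp : p.Prime) (α : ℕ) : majorant w J (p ^ α) =
    if α = 0 then 1 else if α = 1 then w p else ((α : ℝ) + 1) ^ J :=
  ofPrimePowers_prime_pow (g := fun p α => if α = 0 then 1 else if α = 1 then w p else
    ((α : ℝ) + 1) ^ J) (fun _ => by simp) hp α

theorem divisorWeight_prime_pow {p : ℕ} (hp : p.Prime) (α : ℕ) : divisorWeight w J β (p ^ α) =
    if α = 0 then 1 else if α = 1 then w p * (p : ℝ) ^ β - 1 else
      ((α : ℝ) + 1) ^ J * (p : ℝ) ^ (α * β) :=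
  ofPrimePowers_prime_pow (g := fun p α => if α = 0 then 1 else if α = 1 then
    w p * (p : ℝ) ^ β - 1 else ((α : ℝ) + 1) ^ J * (p : ℝ) ^ (α * β)) (fun _ => by simp) hp α

theorem one_le_majorant (hw : ∀ p, 1 ≤ w p) {n : ℕ} (hn : n ≠ 0) : 1 ≤ majorant w J n := by
  rw [majorant_isMultiplicative.multiplicative_factorization _ hn]
  refine Finset.one_le_prod fun p hp => ?_
  beta_reduce
  rw [majorant_prime_pow (Nat.prime_of_mem_primeFactors hp)]
  split_ifs
  · exact le_rfl
  · exact hw p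
  · exact one_le_pow₀ (by linarith [Nat.cast_nonneg (α := ℝ) (n.factorization p)])

theorem majorant_nonneg (hw : ∀ p, 1 ≤ w p) (n : ℕ) : 0 ≤ majorant w J n := by
  rcases eq_or_ne n 0 with rfl | hn
  · simp
  · exact zero_le_one.trans (one_le_majorant hw hn)

/-- At a prime the weight is w(p) p^β - 1, nonnegative because w(p) ≥ 1. For this reason the
majorant is later given the value 1, not 0, at the primes where `F` vanishes. -/
theorem divisorWeight_nonneg (hw : ∀ p, 1 ≤ w p) (hβ : 0 ≤ β) (n : ℕ) :
    0 ≤ divisorWeight w J β n := by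
  refine IsMultiplicative.nonneg_of_prime_pow divisorWeight_isMultiplicative
    (fun p α hp _ => ?_) n
  rw [divisorWeight_prime_pow hp]
  split_ifs
  · exact zero_le_one
  · have h1 : (1 : ℝ) ≤ (p : ℝ) ^ β :=
      Real.one_le_rpow (by exact_mod_cast hp.one_le) hβ
    nlinarith [hw p]
  · positivity

/-- The extreme case is raising an exponent from 1 to 2, which replaces w(p) ≥ 1 by 3^J. -/
theorem majorant_mul_prime_le (hw : ∀ p, 1 ≤ w p) (hwJ : ∀ p, w p ≤ 2 ^ J) {a p : ℕ}
    (hp : p.Prime) : majorant w J (a * p) ≤ majorant w J a * 3 ^ J := by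
  rcases eq_or_ne a 0 with rfl | ha
  · simp
  obtain ⟨i, b, hpb, rfl⟩ := Nat.exists_eq_pow_mul_and_not_dvd ha p hp.ne_one
  have hc : ∀ j, (p ^ j).Coprime b := fun j => Nat.Coprime.pow_left j
    ((Nat.Prime.coprime_iff_not_dvd hp).mpr hpb)
  rw [show p ^ i * b * p = p ^ (i + 1) * b by ring,
    majorant_isMultiplicative.map_mul_of_coprime (hc _),
    majorant_isMultiplicative.map_mul_of_coprime (hc _), mul_right_comm]
  refine mul_le_mul_of_nonneg_right ?_ (majorant_nonneg hw b)
  rw [majorant_prime_pow hp, majorant_prime_pow hp]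
  rcases i with _ | _ | i
  · simp only [zero_add, one_ne_zero, if_false, if_true, one_mul]
    exact (hwJ p).trans (pow_le_pow_left₀ (by norm_num) (by norm_num) J)
  · norm_num
    exact hw p
  · simp only [Nat.add_eq_zero_iff, one_ne_zero, and_false, if_false, Nat.add_eq_right]
    rw [← mul_pow]
    refine pow_le_pow_left₀ (by positivity) ?_ J
    push_cast
    linarith [Nat.cast_nonneg (α := ℝ) i]

theorem majorant_mul_le (hw : ∀ p, 1 ≤ w p) (hwJ : ∀ p, w p ≤ 2 ^ J) (a b : ℕ) :
    majorant w J (a * b) ≤ majorant w J a * (3 ^ J) ^ cardFactors b := by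
  induction b using induction_on_primes generalizing a with
  | zero => simp [majorant_nonneg hw]
  | one => simp
  | prime_mul p b hp ih =>
    rcases eq_or_ne b 0 with rfl | hb
    · simpa using majorant_nonneg hw a
    rw [cardFactors_mul hp.ne_zero hb, cardFactors_apply_prime hp, pow_add, pow_one, ← mul_assoc,
      ← mul_assoc]
    refine (ih _).trans ?_
    gcongr
    exact majorant_mul_prime_le hw hwJ hp

/-- By multiplicativity only prime powers matter. At p the divisor sum equals w(p) p^β exactly; at
p^α with α ≥ 2 the single term d = p^α already suffices. -/
theorem majorant_mul_rpow_le_sum (hw : ∀ p, 1 ≤ w p) (hβ : 0 ≤ β) {n : ℕ} (hn : n ≠ 0) :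
    majorant w J n * (n : ℝ) ^ β ≤ ∑ d ∈ n.divisors, divisorWeight w J β d := by
  have hm : (divisorWeight w J β * (zeta : ArithmeticFunction ℝ)).IsMultiplicative :=
    divisorWeight_isMultiplicative.mul isMultiplicative_zeta.natCast
  rw [← coe_mul_zeta_apply]
  induction n using Nat.recOnPosPrimePosCoprime with
  | zero => exact absurd rfl hn
  | one => simp [majorant_isMultiplicative.map_one, hm.map_one]
  | prime_pow p n hp hpos =>
    have h0 := divisorWeight_nonneg (J := J) hw hβ
    rw [coe_mul_zeta_apply, Nat.sum_divisors_prime_pow hp, majorant_prime_pow hp]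
    rcases n with _ | _ | n
    · simp at hpos
    · simp [Finset.sum_range_succ, divisorWeight_prime_pow hp, -pow_one, -pow_zero]
    · refine le_trans (le_of_eq ?_)
        (Finset.single_le_sum (fun i _ => h0 (p ^ i)) (Finset.self_mem_range_succ (n + 2)))
      rw [divisorWeight_prime_pow hp]
      simp only [Nat.add_eq_zero_iff, one_ne_zero, and_false, if_false, Nat.reduceEqDiff,
        Nat.add_eq_right, OfNat.ofNat_ne_zero]
      rw [Real.rpow_mul (by positivity), Real.rpow_natCast]
      push_cast
      rw [show (n : ℝ) + 1 + 1 = n + 2 by ring]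
  | coprime a b ha hb hab iha ihb =>
    rw [majorant_isMultiplicative.map_mul_of_coprime hab, hm.map_mul_of_coprime hab]
    push_cast
    rw [Real.mul_rpow (by positivity) (by positivity), mul_mul_mul_comm]
    have := majorant_nonneg (J := J) hw a
    have := majorant_nonneg (J := J) hw b
    have ha' := iha (by omega)
    exact mul_le_mul ha' (ihb (by omega)) (by positivity) (le_trans (by positivity) ha')

theorem summable_add_one_pow_mul_geometric (J : ℕ) {r : ℝ} (h0 : 0 < r) (h1 : r < 1) :
    Summable fun n : ℕ => ((n : ℝ) + 1) ^ J * r ^ n := by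
  have h := (summable_nat_add_iff 1).mpr (summable_pow_mul_geometric_of_norm_lt_one (R := ℝ) J
    (r := r) (by rwa [Real.norm_of_nonneg h0.le]))
  refine (h.mul_right r⁻¹).congr fun n => ?_
  push_cast
  rw [pow_succ r]
  field_simp

/-- The divisor-bound argument: primes below `P₀` each cost a factor `C₁`, and for larger ones (α +
1)^J ≤ 2^(Jα) ≤ p^(εα). The constant is independent of `w`. -/
theorem exists_majorant_le_rpow (J : ℕ) {ε : ℝ} (hε : 0 < ε) : ∃ C : ℝ, 0 < C ∧
    ∀ w : ℕ → ℝ, (∀ p, 1 ≤ w p) → (∀ p, w p ≤ 2 ^ J) → ∀ n : ℕ, n ≠ 0 →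
      majorant w J n ≤ C * (n : ℝ) ^ ε := by
  have hr0 : (0 : ℝ) < 2 ^ (-ε) := by positivity
  have hs := summable_add_one_pow_mul_geometric J hr0
    (Real.rpow_lt_one_of_one_lt_of_neg (by norm_num) (by linarith))
  set C₁ : ℝ := max 1 (∑' n : ℕ, ((n : ℝ) + 1) ^ J * (2 ^ (-ε)) ^ n) with hC₁
  have hC₁1 : 1 ≤ C₁ := le_max_left _ _
  have hsmall : ∀ (α p : ℕ), 2 ≤ p → ((α : ℝ) + 1) ^ J ≤ C₁ * ((p : ℝ) ^ ε) ^ α := fun α p hp => by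
    have h1 : ((α : ℝ) + 1) ^ J * (2 ^ (-ε)) ^ α ≤ C₁ :=
      (hs.le_tsum α fun j _ => by positivity).trans (le_max_right _ _)
    have h2 : ((α : ℝ) + 1) ^ J ≤ C₁ * ((2 : ℝ) ^ ε) ^ α := by
      rw [Real.rpow_neg (by norm_num), inv_pow] at h1
      rwa [← div_le_iff₀ (by positivity), div_eq_mul_inv]
    refine h2.trans ?_
    have : (2 : ℝ) ≤ p := by exact_mod_cast hp
    gcongr
  obtain ⟨P₀, hP₀⟩ : ∃ P₀ : ℕ, ∀ p : ℕ, P₀ ≤ p → (2 : ℝ) ^ J ≤ (p : ℝ) ^ ε := by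
    have := ((tendsto_rpow_atTop hε).comp tendsto_natCast_atTop_atTop).eventually_ge_atTop
      ((2 : ℝ) ^ J)
    exact Filter.eventually_atTop.mp this
  refine ⟨C₁ ^ P₀, by positivity, fun w hw hwJ n hn => ?_⟩
  have hlocal : ∀ p ∈ n.primeFactors, majorant w J (p ^ n.factorization p) ≤
      (if p < P₀ then C₁ else 1) * ((p : ℝ) ^ ε) ^ n.factorization p := by
    intro p hp
    have hpp := Nat.prime_of_mem_primeFactors hp
    have h1 : majorant w J (p ^ n.factorization p) ≤ ((n.factorization p : ℝ) + 1) ^ J := by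
      rw [majorant_prime_pow hpp]
      split_ifs with h h'
      · simp [h]
      · rw [h']
        norm_num
        exact hwJ p
      · exact le_rfl
    refine h1.trans ?_
    split_ifs with hlt
    · exact hsmall _ _ hpp.two_le
    · rw [one_mul]
      have h2 : ((n.factorization p : ℝ) + 1) ≤ 2 ^ n.factorization p := by
        exact_mod_cast Nat.lt_two_pow_self
      calc ((n.factorization p : ℝ) + 1) ^ J ≤ (2 ^ n.factorization p) ^ J := by gcongr
        _ = (2 ^ J) ^ n.factorization p := by rw [← pow_mul, ← pow_mul, mul_comm]
        _ ≤ _ := by gcongr; exact hP₀ p (not_lt.mp hlt)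
  rw [majorant_isMultiplicative.multiplicative_factorization _ hn]
  refine (Finset.prod_le_prod (fun p _ => majorant_nonneg hw _) hlocal).trans ?_
  rw [Finset.prod_mul_distrib]
  have h3 : ∏ p ∈ n.primeFactors, ((p : ℝ) ^ ε) ^ n.factorization p = (n : ℝ) ^ ε := by
    conv_rhs => rw [Nat.prod_primeFactors_pow_factorization hn]
    push_cast
    rw [← Real.finsetProd_rpow _ _ (fun p _ => by positivity)]
    refine Finset.prod_congr rfl fun p _ => ?_
    rw [← Real.rpow_natCast, ← Real.rpow_natCast, ← Real.rpow_mul (by positivity),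
      ← Real.rpow_mul (by positivity), mul_comm]
  rw [h3]
  refine mul_le_mul_of_nonneg_right ?_ (by positivity)
  rw [Finset.prod_ite, Finset.prod_const, Finset.prod_const_one, mul_one]
  refine pow_le_pow_right₀ hC₁1 ?_
  refine (Finset.card_le_card (t := Finset.range P₀) fun p hp => ?_).trans (by simp)
  exact Finset.mem_range.mpr (Finset.mem_filter.mp hp).2

end

/-- Induction by removing the largest prime factor. Either the remaining cofactor still lies below V
and the removed prime becomes q, or the removed prime joins b. -/
theorem exists_dvd_le_and_primes_split {n : ℕ} (hn : n ≠ 0) {V : ℝ} (hV : 1 ≤ V) :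
    ∃ a b : ℕ, n = a * b ∧ (a : ℝ) ≤ V ∧ (b = 1 ∨ ∃ q : ℕ, q.Prime ∧ q ∣ b ∧
      (∀ p, p.Prime → p ∣ a → p ≤ q) ∧ (∀ p, p.Prime → p ∣ b → q ≤ p) ∧ V < a * q) := by
  induction n using Nat.strong_induction_on with
  | _ n ih =>
    rcases eq_or_ne n 1 with rfl | hn1
    · exact ⟨1, 1, by simp, by simpa using hV, Or.inl rfl⟩
    by_cases hnV : (n : ℝ) ≤ V
    · exact ⟨n, 1, by simp, hnV, Or.inl rfl⟩
    have hne : n.primeFactors.Nonempty := Nat.nonempty_primeFactors.mpr (by omega)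
    set P := n.primeFactors.max' hne with hP
    have hPmem := Finset.max'_mem _ hne
    have hPp : P.Prime := Nat.prime_of_mem_primeFactors hPmem
    have hPmax : ∀ p, p.Prime → p ∣ n → p ≤ P := fun p hp hpn =>
      Finset.le_max' _ _ (Nat.mem_primeFactors.mpr ⟨hp, hpn, hn⟩)
    obtain ⟨n', hn'⟩ := Nat.dvd_of_mem_primeFactors hPmem
    rw [← hP] at hn'
    have hn'0 : n' ≠ 0 := by rintro rfl; simp at hn'; exact hn hn'
    have hlt : n' < n := by
      rw [hn']
      exact lt_mul_left (Nat.pos_of_ne_zero hn'0) hPp.one_lt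
    obtain ⟨a, b, hab, haV, h⟩ := ih n' hlt hn'0
    rcases h with rfl | ⟨q, hq, hqb, hqa, hqb', hqV⟩
    · refine ⟨a, P, by rw [hn', hab]; ring, haV, Or.inr ⟨P, hPp, dvd_rfl, fun p hp hpa => ?_,
        fun p hp hpP => ?_, ?_⟩⟩
      · exact hPmax p hp (hpa.trans ⟨P, by rw [hn', hab]; ring⟩)
      · exact ((Nat.prime_dvd_prime_iff_eq hp hPp).mp hpP).ge
      · rw [not_le] at hnV
        refine hnV.trans_le (le_of_eq ?_)
        rw [hn', hab]
        push_cast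
        ring
    · refine ⟨a, b * P, by rw [hn', hab]; ring, haV, Or.inr ⟨q, hq, hqb.mul_right _, hqa,
        fun p hp hpb => ?_, hqV⟩⟩
      rcases (Nat.Prime.dvd_mul hp).mp hpb with h1 | h1
      · exact hqb' p hp h1
      · rw [(Nat.prime_dvd_prime_iff_eq hp hPp).mp h1]
        exact hPmax q hq (hqb.trans ⟨a * P, by rw [hn', hab]; ring⟩)

theorem pow_cardFactors_le {q b : ℕ} (hb : b ≠ 0) (h : ∀ p, p.Prime → p ∣ b → q ≤ p) :
    q ^ cardFactors b ≤ b := by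
  conv_rhs => rw [← Nat.prod_primeFactorsList hb]
  rw [cardFactors_apply]
  refine List.pow_card_le_prod _ _ fun p hp => ?_
  exact h p (Nat.prime_of_mem_primeFactorsList hp) (Nat.dvd_of_mem_primeFactorsList hp)

end NormFormSum

/-! ### Euler product bound for sums over smooth numbers. -/

namespace NormFormSum

open ArithmeticFunction

/-- A weak Mertens bound: average log rad(m) ≤ log n over m ≤ n, exchange the sums, and use ⌊n/p⌋ ≥
n/(2p) for p ≤ n. -/
theorem sum_log_prime_div_le (N : ℕ) :
    ∑ p ∈ N.primesBelow, Real.log p / p ≤ 2 * Real.log N := by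
  rcases Nat.eq_zero_or_pos N with rfl | hN
  · simp [Nat.primesBelow]
  obtain ⟨n, rfl⟩ : ∃ n, N = n + 1 := ⟨N - 1, by omega⟩
  rcases Nat.eq_zero_or_pos n with rfl | hn
  · simp [Nat.primesBelow, Finset.sum_filter]
  have hnR : (0 : ℝ) < n := by exact_mod_cast hn
  have h1 : ∑ m ∈ Finset.Ioc 0 n, ∑ p ∈ m.primeFactors, Real.log p ≤ n * Real.log n := by
    calc ∑ m ∈ Finset.Ioc 0 n, ∑ p ∈ m.primeFactors, Real.log p
        ≤ ∑ m ∈ Finset.Ioc 0 n, Real.log n := by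
          refine Finset.sum_le_sum fun m hm => ?_
          rw [Finset.mem_Ioc] at hm
          rw [← Real.log_prod fun p hp =>
            Nat.cast_ne_zero.mpr (Nat.prime_of_mem_primeFactors hp).ne_zero]
          have h2 : ∏ p ∈ m.primeFactors, p ≤ n :=
            (Nat.le_of_dvd hm.1 (Nat.prod_primeFactors_dvd m)).trans hm.2
          refine Real.log_le_log ?_ (by rw [← Nat.cast_prod]; exact Nat.cast_le.mpr h2)
          exact Finset.prod_pos fun p hp =>
            Nat.cast_pos.mpr (Nat.prime_of_mem_primeFactors hp).pos
      _ = n * Real.log n := by simp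
  have h2 : ∑ m ∈ Finset.Ioc 0 n, ∑ p ∈ m.primeFactors, Real.log p =
      ∑ p ∈ (n + 1).primesBelow, ((n / p : ℕ) : ℝ) * Real.log p := by
    rw [Finset.sum_comm' (t' := (n + 1).primesBelow)
      (s' := fun p => (Finset.Ioc 0 n).filter (p ∣ ·))]
    · refine Finset.sum_congr rfl fun p hp => ?_
      rw [Finset.sum_const, nsmul_eq_mul, Nat.Ioc_filter_dvd_card_eq_div]
    · intro m p
      simp only [Finset.mem_Ioc, Nat.mem_primeFactors, Finset.mem_filter, Nat.mem_primesBelow]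
      constructor
      · rintro ⟨⟨h1, h2⟩, h3, h4, -⟩
        have := Nat.le_of_dvd h1 h4
        exact ⟨⟨⟨h1, h2⟩, h4⟩, by omega, h3⟩
      · rintro ⟨⟨⟨h1, h2⟩, h4⟩, -, h3⟩
        exact ⟨⟨h1, h2⟩, h3, h4, by omega⟩
  have h3 : n * ∑ p ∈ (n + 1).primesBelow, Real.log p / p ≤
      2 * ∑ p ∈ (n + 1).primesBelow, ((n / p : ℕ) : ℝ) * Real.log p := by
    rw [Finset.mul_sum, Finset.mul_sum]
    refine Finset.sum_le_sum fun p hp => ?_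
    rw [Nat.mem_primesBelow] at hp
    have hp0 : (0 : ℝ) < p := by exact_mod_cast hp.2.pos
    have hlog : 0 ≤ Real.log p := Real.log_natCast_nonneg p
    have h4 : n ≤ 2 * (n / p) * p := by
      have e1 := Nat.div_add_mod n p
      have e2 := Nat.mod_lt n hp.2.pos
      have e3 : 1 ≤ n / p := Nat.div_pos (by omega) hp.2.pos
      have e4 : p ≤ p * (n / p) := Nat.le_mul_of_pos_right p e3
      have : 2 * (n / p) * p = 2 * (p * (n / p)) := by ring
      omega
    have h5 : (n : ℝ) ≤ 2 * (n / p : ℕ) * p := by exact_mod_cast h4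
    rw [mul_div_assoc', div_le_iff₀ hp0]
    nlinarith
  have h4 : ∑ p ∈ (n + 1).primesBelow, Real.log p / p ≤ 2 * Real.log n := by
    rw [h2] at h1
    refine le_of_mul_le_mul_left (h3.trans ?_) hnR
    linarith
  refine h4.trans ?_
  gcongr
  omega

/-- The geometric mean of the two bounds with weights 3/4 and 1/4: the exponent 3/2 > 1 keeps the
sum over primes convergent, and a quarter of the decay in α survives. -/
theorem interpolate_prime_pow_bound {M κ x γ P : ℝ} (hM : 0 ≤ M) (hx : 0 ≤ x) (hP : 0 < P)
    (hκ : κ = 4 * γ) {α : ℕ} (h2 : x ≤ M / P ^ 2) (h3 : x ≤ M * P ^ (-(κ * α))) :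
    x ≤ M * P ^ (-(3 / 2) : ℝ) * (P ^ (-γ)) ^ α := by
  calc x = x ^ (3 / 4 : ℝ) * x ^ (1 / 4 : ℝ) := by
        rw [← Real.rpow_add_of_nonneg hx (by norm_num) (by norm_num)]
        norm_num
    _ ≤ (M / P ^ 2) ^ (3 / 4 : ℝ) * (M * P ^ (-(κ * α))) ^ (1 / 4 : ℝ) := by gcongr
    _ = (M ^ (3 / 4 : ℝ) * M ^ (1 / 4 : ℝ)) * P ^ (-(3 / 2) : ℝ) * (P ^ (-γ)) ^ α := by
        rw [Real.div_rpow hM (by positivity), Real.mul_rpow hM (by positivity),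
          ← Real.rpow_natCast, ← Real.rpow_mul hP.le, ← Real.rpow_mul hP.le,
          ← Real.rpow_natCast (P ^ (-γ)), ← Real.rpow_mul hP.le, Real.rpow_neg hP.le (3 / 2), hκ]
        norm_num
        rw [show 4 * γ * α * (1 / 4) = γ * α by ring]
        ring
    _ = M * P ^ (-(3 / 2) : ℝ) * (P ^ (-γ)) ^ α := by
        rw [← Real.rpow_add_of_nonneg hM (by norm_num) (by norm_num)]
        norm_num

/-- Each Euler factor is at most the exponential of (w(p) - 1) δ(p) plus two errors. Replacing p^β
by 1 costs O(β log p / p), which sums to O(1) since β log N ≤ c; the powers α ≥ 2 cost O(p^(-3/2)).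
-/
theorem exists_sum_smoothNumbers_le (K M γ c : ℝ) (hK : 1 ≤ K) (hM : 0 ≤ M) (hγ : 0 < γ)
    (J : ℕ) : ∃ C : ℝ, ∀ (δ w : ℕ → ℝ), (∀ n, 0 ≤ δ n) → δ 1 = 1 →
      (∀ a b : ℕ, a.Coprime b → δ (a * b) = δ a * δ b) → (∀ p, 1 ≤ w p) → (∀ p, w p ≤ K) →
      (∀ p : ℕ, p.Prime → δ p ≤ K / p) →
      (∀ p α : ℕ, p.Prime → 2 ≤ α →
        δ (p ^ α) ≤ M * (p : ℝ) ^ (-(3 / 2) : ℝ) * ((p : ℝ) ^ (-γ)) ^ α) →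
      ∀ (N : ℕ) (β : ℝ) (T : Finset ℕ), 0 ≤ β → β ≤ γ / 2 → β * Real.log N ≤ c →
        (∀ d ∈ T, d ∈ N.smoothNumbers) →
        ∑ d ∈ T, divisorWeight w J β d * δ d ≤
          Real.exp C * Real.exp (∑ p ∈ N.primesBelow, (w p - 1) * δ p) := by
  set r : ℝ := 2 ^ (-(γ / 2)) with hr
  have hr0 : 0 < r := by positivity
  have hr1 : r < 1 := Real.rpow_lt_one_of_one_lt_of_neg (by norm_num) (by linarith)
  have hrs := summable_add_one_pow_mul_geometric J hr0 hr1
  set S : ℝ := ∑' n : ℕ, ((n : ℝ) + 1) ^ J * r ^ n with hS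
  have hS0 : 0 ≤ S := tsum_nonneg fun n => by positivity
  have hz : Summable fun n : ℕ => (n : ℝ) ^ (-(3 / 2) : ℝ) :=
    Real.summable_nat_rpow.mpr (by norm_num)
  set Z : ℝ := ∑' n : ℕ, (n : ℝ) ^ (-(3 / 2) : ℝ) with hZ
  refine ⟨2 * K ^ 2 * Real.exp c * c + M * S * Z, ?_⟩
  intro δ w hδ0 hδ1 hδm hw hwK hδp hδpp N β T hβ hβγ hβc hT
  set f : ℕ → ℝ := fun d => divisorWeight w J β d * δ d with hf
  have hf0 : ∀ n, 0 ≤ f n := fun n => mul_nonneg (divisorWeight_nonneg hw hβ n) (hδ0 n)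
  have hf1 : f 1 = 1 := by simp [hf, divisorWeight_isMultiplicative.map_one, hδ1]
  have hfm : ∀ {a b : ℕ}, a.Coprime b → f (a * b) = f a * f b := fun {a b} hab => by
    simp only [hf]
    rw [divisorWeight_isMultiplicative.map_mul_of_coprime hab, hδm a b hab]
    ring
  have hfpp : ∀ p n : ℕ, p.Prime → f (p ^ (n + 2)) ≤
      M * (p : ℝ) ^ (-(3 / 2) : ℝ) * (((n + 2 : ℕ) + 1 : ℝ) ^ J * r ^ (n + 2)) := fun p n hp => by
    have hp2 : (2 : ℝ) ≤ p := by exact_mod_cast hp.two_le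
    have hp0 : (0 : ℝ) < p := by linarith
    simp only [hf]
    rw [divisorWeight_prime_pow hp, if_neg (by omega), if_neg (by omega)]
    calc _ ≤ (((n + 2 : ℕ) : ℝ) + 1) ^ J * (p : ℝ) ^ (((n + 2 : ℕ) : ℝ) * β) *
          (M * (p : ℝ) ^ (-(3 / 2) : ℝ) * ((p : ℝ) ^ (-γ)) ^ (n + 2)) := by
          gcongr
          exact hδpp p (n + 2) hp (by omega)
      _ = M * (p : ℝ) ^ (-(3 / 2) : ℝ) * ((((n + 2 : ℕ) : ℝ) + 1) ^ J *
          ((p : ℝ) ^ (β - γ)) ^ (n + 2)) := by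
          rw [mul_comm _ β, Real.rpow_mul hp0.le, Real.rpow_natCast, sub_eq_add_neg,
            Real.rpow_add hp0, mul_pow]
          ring
      _ ≤ _ := by
          have h1 : (p : ℝ) ^ (β - γ) ≤ r := by
            calc (p : ℝ) ^ (β - γ) ≤ (p : ℝ) ^ (-(γ / 2)) :=
                  Real.rpow_le_rpow_of_exponent_le (by linarith) (by linarith)
              _ ≤ r := Real.rpow_le_rpow_of_nonpos (by norm_num) hp2 (by linarith)
          gcongr
  have hsum2 : ∀ p : ℕ, p.Prime → Summable fun n => f (p ^ (n + 2)) := fun p hp => by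
    refine Summable.of_nonneg_of_le (fun n => hf0 _) (fun n => hfpp p n hp) ?_
    exact ((summable_nat_add_iff 2).mpr hrs).mul_left _
  have hsum : ∀ {p : ℕ}, p.Prime → Summable fun n => ‖f (p ^ n)‖ := fun {p} hp => by
    simp_rw [Real.norm_of_nonneg (hf0 _)]
    exact (summable_nat_add_iff 2).mp (hsum2 p hp)
  obtain ⟨-, hprod⟩ :=
    EulerProduct.summable_and_hasSum_smoothNumbers_prod_primesBelow_tsum hf1 hfm hsum N
  have hle : ∑ d ∈ T, f d ≤ ∏ p ∈ N.primesBelow, ∑' n : ℕ, f (p ^ n) := by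
    have h1 : ∑ d ∈ T, f d = ∑ d ∈ T.subtype (· ∈ N.smoothNumbers), f d := by
      rw [Finset.sum_subtype_of_mem f hT]
    rw [h1]
    exact sum_le_hasSum _ (fun d _ => hf0 d) hprod
  refine hle.trans ?_
  have hlocal : ∀ p ∈ N.primesBelow, ∑' n : ℕ, f (p ^ n) ≤ Real.exp ((w p - 1) * δ p +
      (K ^ 2 * Real.exp c * β * (Real.log p / p) + M * S * (p : ℝ) ^ (-(3 / 2) : ℝ))) := by
    intro p hp
    rw [Nat.mem_primesBelow] at hp
    obtain ⟨hpN, hp⟩ := hp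
    have hp2 : (2 : ℝ) ≤ p := by exact_mod_cast hp.two_le
    have hp0 : (0 : ℝ) < p := by linarith
    have hs : Summable fun n => f (p ^ n) := (summable_nat_add_iff 2).mp (hsum2 p hp)
    rw [← hs.sum_add_tsum_nat_add 2, Finset.sum_range_succ, Finset.sum_range_one, pow_zero, hf1,
      pow_one]
    have htail : ∑' n : ℕ, f (p ^ (n + 2)) ≤ M * S * (p : ℝ) ^ (-(3 / 2) : ℝ) := by
      have hrs2 := (summable_nat_add_iff 2).mpr hrs
      calc ∑' n : ℕ, f (p ^ (n + 2)) ≤ ∑' n : ℕ, M * (p : ℝ) ^ (-(3 / 2) : ℝ) *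
            (((n + 2 : ℕ) + 1 : ℝ) ^ J * r ^ (n + 2)) :=
            (hsum2 p hp).tsum_le_tsum (fun n => hfpp p n hp) (hrs2.mul_left _)
        _ = M * (p : ℝ) ^ (-(3 / 2) : ℝ) * ∑' n : ℕ, (((n + 2 : ℕ) + 1 : ℝ) ^ J * r ^ (n + 2)) :=
            tsum_mul_left
        _ ≤ M * (p : ℝ) ^ (-(3 / 2) : ℝ) * S := by
            gcongr
            rw [hS, ← hrs.sum_add_tsum_nat_add 2]
            exact le_add_of_nonneg_left (Finset.sum_nonneg fun n _ => by positivity)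
        _ = _ := by ring
    have hfp : f p ≤ (w p - 1) * δ p + K ^ 2 * Real.exp c * β * (Real.log p / p) := by
      have e1 : f p = (w p - 1) * δ p + w p * ((p : ℝ) ^ β - 1) * δ p := by
        have := divisorWeight_prime_pow (w := w) (J := J) (β := β) hp 1
        simp only [pow_one, one_ne_zero, if_false, if_true] at this
        simp only [hf, this]
        ring
      rw [e1]
      have hx0 : 0 ≤ β * Real.log p := mul_nonneg hβ (Real.log_nonneg (by linarith))
      have hxc : β * Real.log p ≤ c := by
        refine le_trans ?_ hβc
        gcongr
      have e2 : (p : ℝ) ^ β - 1 ≤ Real.exp c * (β * Real.log p) := by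
        rw [Real.rpow_def_of_pos hp0, mul_comm (Real.log _)]
        have h1 : Real.exp (β * Real.log p) - 1 ≤ Real.exp (β * Real.log p) * (β * Real.log p) := by
          have h2 := Real.add_one_le_exp (-(β * Real.log p))
          have h3 := Real.exp_pos (β * Real.log p)
          have h4 : Real.exp (β * Real.log p) * Real.exp (-(β * Real.log p)) = 1 := by
            rw [← Real.exp_add]; simp
          nlinarith
        refine h1.trans ?_
        gcongr
      have e3 : 0 ≤ (p : ℝ) ^ β - 1 := by
        have := Real.one_le_rpow (x := (p : ℝ)) (by linarith) hβ
        linarith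
      have e4 : w p * ((p : ℝ) ^ β - 1) * δ p ≤ K * (Real.exp c * (β * Real.log p)) * (K / p) := by
        have := hδ0 p
        have := hw p
        gcongr
        · exact hwK p
        · exact hδp p hp
      have e5 : K * (Real.exp c * (β * Real.log p)) * (K / p) =
          K ^ 2 * Real.exp c * β * (Real.log p / p) := by ring
      linarith
    refine le_trans ?_ (Real.add_one_le_exp _)
    linarith
  refine (Finset.prod_le_prod (fun p _ => tsum_nonneg fun n => hf0 _) hlocal).trans ?_
  rw [← Real.exp_sum, ← Real.exp_add]
  refine Real.exp_le_exp.mpr ?_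
  rw [Finset.sum_add_distrib, Finset.sum_add_distrib, add_comm]
  gcongr ?_ + _
  rw [← Finset.mul_sum, ← Finset.mul_sum]
  have e1 := sum_log_prime_div_le N
  have e2 : ∑ p ∈ N.primesBelow, (p : ℝ) ^ (-(3 / 2) : ℝ) ≤ Z :=
    hz.sum_le_tsum _ fun n _ => by positivity
  have e3 : K ^ 2 * Real.exp c * β * ∑ p ∈ N.primesBelow, Real.log p / p ≤
      2 * K ^ 2 * Real.exp c * c := by
    calc _ ≤ K ^ 2 * Real.exp c * β * (2 * Real.log N) := by gcongr
      _ = 2 * K ^ 2 * Real.exp c * (β * Real.log N) := by ring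
      _ ≤ _ := by gcongr
  gcongr

end NormFormSum

/-! ### The Wolke–Nair argument. -/

namespace NormFormSum

open ArithmeticFunction

/-- The positive integers up to `V` all of whose prime factors are less than `N`. -/
noncomputable def smoothUpTo (V : ℝ) (N : ℕ) : Finset ℕ :=
  (Finset.Icc 1 ⌊V⌋₊).filter (· ∈ N.smoothNumbers)

theorem mem_smoothUpTo {V : ℝ} (hV : 0 ≤ V) {N d : ℕ} :
    d ∈ smoothUpTo V N ↔ (0 < d ∧ (d : ℝ) ≤ V) ∧ d ∈ N.smoothNumbers := by
  rw [smoothUpTo, Finset.mem_filter, Finset.mem_Icc, Nat.le_floor_iff hV]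
  rfl

/-- The sum of `divisorWeight w J β d` over the divisors `d ≤ V` of `n` whose prime factors are at
most `y`. -/
noncomputable def smoothDivisorSum (w : ℕ → ℝ) (J : ℕ) (V β y : ℝ) (n : ℕ) : ℝ :=
  ∑ d ∈ (smoothUpTo V (⌊y⌋₊ + 1)).filter (· ∣ n), divisorWeight w J β d

section

variable {w : ℕ → ℝ} {J : ℕ} {V β y : ℝ}

theorem smoothDivisorSum_nonneg (hw : ∀ p, 1 ≤ w p) (hβ : 0 ≤ β) (n : ℕ) :
    0 ≤ smoothDivisorSum w J V β y n :=
  Finset.sum_nonneg fun d _ => divisorWeight_nonneg hw hβ d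

theorem majorant_mul_rpow_le_smoothDivisorSum (hw : ∀ p, 1 ≤ w p) (hβ : 0 ≤ β) (hV : 0 ≤ V)
    {a n : ℕ} (ha : a ≠ 0) (han : a ∣ n) (haV : (a : ℝ) ≤ V)
    (hay : ∀ p : ℕ, p.Prime → p ∣ a → (p : ℝ) ≤ y) :
    majorant w J a * (a : ℝ) ^ β ≤ smoothDivisorSum w J V β y n := by
  refine (majorant_mul_rpow_le_sum hw hβ ha).trans ?_
  refine Finset.sum_le_sum_of_subset_of_nonneg (fun d hd => ?_)
    fun d _ _ => divisorWeight_nonneg hw hβ d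
  have hda := Nat.dvd_of_mem_divisors hd
  have hd0 : 0 < d := Nat.pos_of_mem_divisors hd
  refine Finset.mem_filter.mpr ⟨(mem_smoothUpTo hV).mpr ⟨⟨hd0, ?_⟩, ?_⟩, hda.trans han⟩
  · exact le_trans (by exact_mod_cast Nat.le_of_dvd (Nat.pos_of_ne_zero ha) hda) haV
  · rw [Nat.mem_smoothNumbers']
    intro p hp hpd
    exact Nat.lt_succ_of_le (Nat.le_floor (hay p hp (hpd.trans hda)))

theorem sum_smoothDivisorSum_le {m : ℕ} (N : (Fin m → ℤ) → ℕ) (hw : ∀ p, 1 ≤ w p) (hβ : 0 ≤ β)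
    (hV : 0 ≤ V) : ∑ v ∈ nonzeroBall m V, smoothDivisorSum w J V β y (N v) ≤
      (4 * V) ^ m * ∑ d ∈ smoothUpTo V (⌊y⌋₊ + 1), divisorWeight w J β d * dvdDensity N d := by
  classical
  unfold smoothDivisorSum
  simp_rw [Finset.sum_filter]
  rw [Finset.sum_comm, Finset.mul_sum]
  refine Finset.sum_le_sum fun d hd => ?_
  obtain ⟨⟨hd0, hdV⟩, -⟩ := (mem_smoothUpTo hV).mp hd
  rw [← Finset.sum_filter, Finset.sum_const, nsmul_eq_mul]
  have h1 := card_dvd_le N hd0 hdV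
  have h2 := divisorWeight_nonneg (J := J) hw hβ d
  calc _ ≤ ((4 * V) ^ m * dvdDensity N d) * divisorWeight w J β d := by
        refine mul_le_mul_of_nonneg_right ?_ h2
        convert h1
    _ = _ := by ring

/-- The three terms correspond to q large, q near V^(1/s), and q bounded. All terms are nonnegative,
so in each case one of them suffices. -/
theorem majorant_le_sum_smoothDivisorSum (hw : ∀ p, 1 ≤ w p) (hwJ : ∀ p, w p ≤ 2 ^ J)
    {κ : ℕ} (hκ : 0 < κ) {β₀ : ℝ} (hβ₀ : 0 < β₀) {c : ℝ}
    (hc : c = 2 * (κ * Real.log (3 ^ J) + 1)) {C : ℝ} (hC : 0 < C) {n : ℕ} (hn : n ≠ 0)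
    (hCn : majorant w J n ≤ C * (n : ℝ) ^ (β₀ / κ)) (hV : 2 ≤ V)
    (hnV : (n : ℝ) ≤ V ^ κ) :
    majorant w J n ≤ (3 ^ J) ^ (2 * κ) * smoothDivisorSum w J V 0 V n +
      ∑ s ∈ Finset.Icc 1 ⌊β₀ * Real.log V / c⌋₊, (3 ^ J) ^ κ * Real.exp (-s) *
        smoothDivisorSum w J V (c * s / Real.log V) (V ^ (1 / s : ℝ)) n +
      C * Real.exp c * smoothDivisorSum w J V β₀ (min (Real.exp (c / β₀)) V) n := by
  have hV0 : 0 < V := by linarith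
  have hL : 0 < Real.log V := Real.log_pos (by linarith)
  have hB1 : (1 : ℝ) ≤ 3 ^ J := one_le_pow₀ (by norm_num)
  have hc0 : 0 < c := by
    have := Real.log_nonneg hB1
    rw [hc]; positivity
  have hbeta : ∀ s : ℕ, 0 ≤ c * s / Real.log V := fun s => by positivity
  have h1 : 0 ≤ (3 ^ J) ^ (2 * κ) * smoothDivisorSum w J V 0 V n :=
    mul_nonneg (by positivity) (smoothDivisorSum_nonneg hw le_rfl n)
  have h2 : ∀ s : ℕ, 0 ≤ (3 ^ J) ^ κ * Real.exp (-s) *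
      smoothDivisorSum w J V (c * s / Real.log V) (V ^ (1 / s : ℝ)) n := fun s =>
    mul_nonneg (by positivity) (smoothDivisorSum_nonneg hw (hbeta s) n)
  have h3 : 0 ≤ C * Real.exp c * smoothDivisorSum w J V β₀ (min (Real.exp (c / β₀)) V) n :=
    mul_nonneg (by positivity) (smoothDivisorSum_nonneg hw hβ₀.le n)
  have h2' := Finset.sum_nonneg fun s (_ : s ∈ Finset.Icc 1 ⌊β₀ * Real.log V / c⌋₊) => h2 s
  obtain ⟨a, b, hab, haV, hsplit⟩ := exists_dvd_le_and_primes_split hn (V := V) (by linarith)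
  have ha : a ≠ 0 := by rintro rfl; simp at hab; exact hn hab
  have hb : b ≠ 0 := by rintro rfl; simp at hab; exact hn hab
  have han : a ∣ n := ⟨b, hab⟩
  have haR : (0 : ℝ) < a := by exact_mod_cast Nat.pos_of_ne_zero ha
  have hG1 : 1 ≤ majorant w J a := one_le_majorant hw ha
  have hmul : majorant w J n ≤ majorant w J a * (3 ^ J) ^ cardFactors b := by
    rw [hab]; exact majorant_mul_le hw hwJ a b
  have hmain : cardFactors b ≤ 2 * κ → majorant w J n ≤
      (3 ^ J) ^ (2 * κ) * smoothDivisorSum w J V 0 V n := fun hΩ => by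
    have h4 := majorant_mul_rpow_le_smoothDivisorSum (J := J) (β := 0) hw le_rfl hV0.le ha
      han haV fun p hp hpa => le_trans
        (by exact_mod_cast Nat.le_of_dvd (Nat.pos_of_ne_zero ha) hpa) haV
    rw [Real.rpow_zero, mul_one] at h4
    have h5 := smoothDivisorSum_nonneg (J := J) (V := V) (y := V) hw le_rfl n
    calc majorant w J n ≤ majorant w J a * (3 ^ J) ^ cardFactors b := hmul
      _ ≤ smoothDivisorSum w J V 0 V n * (3 ^ J) ^ (2 * κ) := by gcongr
      _ = _ := mul_comm _ _
  rcases hsplit with rfl | ⟨q, hq, hqb, hqa, hqb', hqV⟩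
  · have := hmain (by simp)
    linarith
  have hbn : b ≤ n := Nat.le_of_dvd (Nat.pos_of_ne_zero hn) ⟨a, by rw [hab, mul_comm]⟩
  have hqΩ : (q : ℝ) ^ cardFactors b ≤ V ^ κ :=
    le_trans (by exact_mod_cast (pow_cardFactors_le hb hqb').trans hbn) hnV
  have hq1 : (1 : ℝ) < q := by exact_mod_cast hq.one_lt
  have hlq : 0 < Real.log q := Real.log_pos hq1
  set F : ℕ := ⌊V⌋₊ with hF
  have hF0 : F ≠ 0 := (Nat.floor_pos.mpr (by linarith)).ne'
  -- This makes q^s ≤ V < q^(s+1). Since all primes of b are at least q and b ≤ V^κ, b has at most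
  -- κ(s + 1) prime factors.
  set s : ℕ := Nat.log q F with hs
  have hs1 : (q : ℝ) ^ s ≤ V := by
    have h4 : q ^ s ≤ F := Nat.pow_log_le_self q hF0
    exact le_trans (by exact_mod_cast h4) (Nat.floor_le hV0.le)
  have hs2 : V < (q : ℝ) ^ (s + 1) := by
    have h4 : F < q ^ (s + 1) := Nat.lt_pow_succ_log_self hq.one_lt F
    have h5 : ((F + 1 : ℕ) : ℝ) ≤ (q : ℝ) ^ (s + 1) := by exact_mod_cast h4
    refine lt_of_lt_of_le (Nat.lt_floor_add_one V) ?_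
    push_cast at h5
    exact h5
  have hΩ : cardFactors b ≤ κ * (s + 1) := by
    have h4 : (q : ℝ) ^ cardFactors b ≤ (q : ℝ) ^ ((s + 1) * κ) := by
      rw [pow_mul]
      exact hqΩ.trans (pow_le_pow_left₀ hV0.le hs2.le κ)
    have h5 := (pow_le_pow_iff_right₀ hq1).mp h4
    rwa [mul_comm]
  rcases Nat.lt_or_ge s 2 with hs_lt | hs_ge
  · have := hmain (hΩ.trans (by nlinarith))
    linarith
  have hs0 : (0 : ℝ) < s := by exact_mod_cast (by omega : 0 < s)
  have hlogs : s * Real.log q ≤ Real.log V := by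
    have := Real.log_le_log (by positivity) hs1
    rwa [Real.log_pow] at this
  rcases le_or_gt (c * s / Real.log V) β₀ with hβs | hβs
  · have hmem : s ∈ Finset.Icc 1 ⌊β₀ * Real.log V / c⌋₊ := by
      refine Finset.mem_Icc.mpr ⟨by omega, Nat.le_floor ?_⟩
      rw [le_div_iff₀ hc0]
      rw [div_le_iff₀ hL] at hβs
      linarith
    have h4 := majorant_mul_rpow_le_smoothDivisorSum (J := J) (β := c * s / Real.log V)
      (y := V ^ (1 / s : ℝ)) hw (hbeta s) hV0.le ha han haV fun p hp hpa => by
        have hpq : (p : ℝ) ≤ q := by exact_mod_cast hqa p hp hpa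
        refine hpq.trans ?_
        rw [one_div, Real.le_rpow_inv_iff_of_pos (by positivity) hV0.le hs0, Real.rpow_natCast]
        exact hs1
    -- For s ≥ 2 one has q ≤ √V, so a < √V would contradict V < aq.
    have hVa : V ^ (1 / 2 : ℝ) ≤ a := by
      have h5 : (q : ℝ) ≤ V ^ (1 / 2 : ℝ) := by
        rw [one_div, Real.le_rpow_inv_iff_of_pos (by positivity) hV0.le (by norm_num)]
        refine le_trans ?_ hs1
        exact_mod_cast pow_le_pow_right₀ hq1.le hs_ge
      have h6 : V ^ (1 / 2 : ℝ) * V ^ (1 / 2 : ℝ) = V := by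
        rw [← Real.rpow_add hV0]; norm_num
      have h7 : 0 < V ^ (1 / 2 : ℝ) := by positivity
      by_contra! h8
      have : (a : ℝ) * q ≤ V ^ (1 / 2 : ℝ) * V ^ (1 / 2 : ℝ) := by gcongr
      linarith
    have h5 : Real.exp (c * s / 2) ≤ (a : ℝ) ^ (c * s / Real.log V) := by
      refine le_trans (le_of_eq ?_) (Real.rpow_le_rpow (by positivity) hVa (hbeta s))
      rw [← Real.rpow_mul hV0.le, Real.rpow_def_of_pos hV0]
      congr 1
      field_simp
    -- The constant c is chosen so that e^(cs/2) = (3^J)^(κs) e^s.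
    have h6 : (((3 : ℝ) ^ J) ^ (κ * (s + 1))) =
        (3 ^ J) ^ κ * Real.exp (-s) * Real.exp (c * s / 2) := by
      have h7 : ((3 : ℝ) ^ J) ^ (κ * s) = Real.exp (-s) * Real.exp (c * s / 2) := by
        rw [← Real.exp_log (x := ((3 : ℝ) ^ J) ^ (κ * s)) (by positivity), ← Real.exp_add,
          Real.log_pow, hc]
        congr 1
        push_cast
        ring
      rw [mul_add, mul_one, pow_add, h7]
      ring
    have h7 : majorant w J n ≤ (3 ^ J) ^ κ * Real.exp (-s) *
        smoothDivisorSum w J V (c * s / Real.log V) (V ^ (1 / s : ℝ)) n := by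
      calc majorant w J n ≤ majorant w J a * (3 ^ J) ^ cardFactors b := hmul
        _ ≤ majorant w J a * (3 ^ J) ^ (κ * (s + 1)) := by gcongr
        _ = (3 ^ J) ^ κ * Real.exp (-s) * (majorant w J a * Real.exp (c * s / 2)) := by
            rw [h6]; ring
        _ ≤ (3 ^ J) ^ κ * Real.exp (-s) *
            (majorant w J a * (a : ℝ) ^ (c * s / Real.log V)) := by gcongr
        _ ≤ _ := by gcongr
    have h8 := Finset.single_le_sum (fun s _ => h2 s) hmem
    linarith
  -- Here cs/log V > β₀, and s log q ≤ log V bounds q by e^(c/β₀); hence V < aq yields V^β₀ ≤ e^c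
  -- a^β₀.
  · have hqQ : (q : ℝ) ≤ Real.exp (c / β₀) := by
      rw [← Real.log_le_iff_le_exp (by positivity), le_div_iff₀ hβ₀]
      rw [lt_div_iff₀ hL] at hβs
      nlinarith
    have hqV' : (q : ℝ) ≤ V := le_trans (le_self_pow₀ hq1.le (by omega)) hs1
    have h4 := majorant_mul_rpow_le_smoothDivisorSum (J := J) (β := β₀)
      (y := min (Real.exp (c / β₀)) V) hw hβ₀.le hV0.le ha han haV
        fun p hp hpa => by
          have hpq : (p : ℝ) ≤ q := by exact_mod_cast hqa p hp hpa
          exact hpq.trans (le_min hqQ hqV')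
    have h5 : V ^ β₀ ≤ Real.exp c * (a : ℝ) ^ β₀ := by
      calc V ^ β₀ ≤ (a * Real.exp (c / β₀)) ^ β₀ := by
            refine Real.rpow_le_rpow hV0.le (hqV.le.trans ?_) hβ₀.le
            gcongr
        _ = Real.exp c * (a : ℝ) ^ β₀ := by
            rw [Real.mul_rpow haR.le (Real.exp_pos _).le, ← Real.exp_mul,
              div_mul_cancel₀ _ hβ₀.ne', mul_comm]
    have h6 : (n : ℝ) ^ (β₀ / κ) ≤ V ^ β₀ := by
      have hκR : (0 : ℝ) < κ := by exact_mod_cast hκ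
      calc (n : ℝ) ^ (β₀ / κ) ≤ (V ^ κ) ^ (β₀ / κ) := by gcongr
        _ = V ^ β₀ := by
            rw [← Real.rpow_natCast, ← Real.rpow_mul hV0.le, mul_div_cancel₀ _ hκR.ne']
    have h7 : majorant w J n ≤
        C * Real.exp c * smoothDivisorSum w J V β₀ (min (Real.exp (c / β₀)) V) n := by
      calc majorant w J n ≤ C * (n : ℝ) ^ (β₀ / κ) := hCn
        _ ≤ C * (Real.exp c * (a : ℝ) ^ β₀) := by
            gcongr
            exact h6.trans h5
        _ ≤ C * (Real.exp c * (majorant w J a * (a : ℝ) ^ β₀)) := by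
            gcongr
            exact le_mul_of_one_le_left (by positivity) hG1
        _ ≤ C * (Real.exp c * smoothDivisorSum w J V β₀ (min (Real.exp (c / β₀)) V) n) := by
            gcongr
        _ = _ := by ring
    linarith

end

/-- The pairs (β, y) that occur all satisfy β log y ≤ c, with equality for β = cs/log V and y =
V^(1/s). The smooth divisor sums are therefore bounded uniformly, and e^(-s) makes the sum over s
converge. -/
theorem exists_sum_majorant_le {m e J κ : ℕ} {K M γ C₀ : ℝ} (N : (Fin m → ℤ) → ℕ) (w : ℕ → ℝ)
    (hN : DvdPeriodic N) (hw : ∀ p, 1 ≤ w p) (hwK : ∀ p, w p ≤ K) (hwJ : ∀ p, w p ≤ 2 ^ J)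
    (hM : 0 ≤ M) (hγ : 0 < γ) (hκ : 0 < κ)
    (hp : ∀ p : ℕ, p.Prime → dvdDensity N p ≤ K / p)
    (hpp : ∀ p α : ℕ, p.Prime → 2 ≤ α →
      dvdDensity N (p ^ α) ≤ M * (p : ℝ) ^ (-(3 / 2) : ℝ) * ((p : ℝ) ^ (-γ)) ^ α)
    (hball : ∀ V : ℝ, 2 ≤ V → ∀ v ∈ nonzeroBall m V, N v ≠ 0 ∧ (N v : ℝ) ≤ V ^ κ)
    (hmean : ∀ V : ℝ, 2 ≤ V → ∀ n : ℕ, (n : ℝ) ≤ V + 1 →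
      Real.exp (∑ p ∈ n.primesBelow, (w p - 1) * dvdDensity N p) ≤ C₀ * Real.log V ^ e) :
    ∃ D : ℝ, ∀ V : ℝ, 2 ≤ V →
      ∑ v ∈ nonzeroBall m V, majorant w J (N v) ≤ D * (V ^ m * Real.log V ^ e) := by
  have hK : 1 ≤ K := (hw 0).trans (hwK 0)
  set β₀ : ℝ := γ / 2 with hβ₀
  have hβ₀0 : 0 < β₀ := by positivity
  set c : ℝ := 2 * (κ * Real.log (3 ^ J) + 1) with hc
  have hc0 : 0 < c := by
    have := Real.log_nonneg (one_le_pow₀ (by norm_num) : (1 : ℝ) ≤ 3 ^ J)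
    rw [hc]; positivity
  obtain ⟨C, hC, hCn⟩ := exists_majorant_le_rpow J (ε := β₀ / κ) (by positivity)
  -- The extra β₀ log 2 allows for ⌊y⌋ + 1 ≤ 2y, needed because `smoothNumbers` uses a strict bound
  -- on primes.
  obtain ⟨C₁, hC₁⟩ := exists_sum_smoothNumbers_le K M γ (c + β₀ * Real.log 2) hK hM hγ J
  set E : ℝ := 4 ^ m * (Real.exp C₁ * C₀) with hE
  have hS : ∀ V β y : ℝ, 2 ≤ V → 0 ≤ β → β ≤ β₀ → 1 ≤ y → y ≤ V → β * Real.log y ≤ c →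
      ∑ v ∈ nonzeroBall m V, smoothDivisorSum w J V β y (N v) ≤
        E * (V ^ m * Real.log V ^ e) := by
    intro V β y hV hβ hββ hy hyV hβy
    have hV0 : 0 ≤ V := by linarith
    refine (sum_smoothDivisorSum_le N hw hβ hV0).trans ?_
    have hle : ((⌊y⌋₊ + 1 : ℕ) : ℝ) ≤ y + 1 := by
      push_cast
      linarith [Nat.floor_le (by linarith : 0 ≤ y)]
    have h1 := hC₁ (dvdDensity N) w (dvdDensity_nonneg N) (dvdDensity_one N)
      (fun a b => dvdDensity_mul hN) hw hwK hp hpp (⌊y⌋₊ + 1) β (smoothUpTo V (⌊y⌋₊ + 1))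
      hβ hββ ?_ fun d hd => ((mem_smoothUpTo hV0).mp hd).2
    · have h2 := hmean V hV (⌊y⌋₊ + 1) (hle.trans (by linarith))
      calc _ ≤ (4 * V) ^ m * (Real.exp C₁ * (C₀ * Real.log V ^ e)) := by
            gcongr
            exact h1.trans (by gcongr)
        _ = _ := by rw [hE, mul_pow]; ring
    · have h3 : Real.log ((⌊y⌋₊ + 1 : ℕ) : ℝ) ≤ Real.log y + Real.log 2 := by
        rw [← Real.log_mul (by linarith) (by norm_num)]
        exact Real.log_le_log (by positivity) (by linarith)
      have h4 : 0 ≤ Real.log 2 := Real.log_nonneg (by norm_num)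
      calc β * Real.log ((⌊y⌋₊ + 1 : ℕ) : ℝ) ≤ β * (Real.log y + Real.log 2) := by gcongr
        _ = β * Real.log y + β * Real.log 2 := by ring
        _ ≤ _ := by gcongr
  have hsum := Real.summable_exp_neg_nat
  refine ⟨((3 ^ J) ^ (2 * κ) + (3 ^ J) ^ κ * (∑' s : ℕ, Real.exp (-s)) + C * Real.exp c) * E,
    fun V hV => ?_⟩
  have hV0 : 0 < V := by linarith
  have hL : 0 < Real.log V := Real.log_pos (by linarith)
  set X : ℝ := V ^ m * Real.log V ^ e with hX
  -- No sign of `C₀` is assumed; nonnegativity follows because the product bounds a nonnegative sum.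
  have hE0 : 0 ≤ E * X := by
    refine le_trans ?_ (hS V 0 1 hV le_rfl hβ₀0.le le_rfl (by linarith) (by simpa using hc0.le))
    exact Finset.sum_nonneg fun v _ => smoothDivisorSum_nonneg hw le_rfl _
  have h1 := hS V 0 V hV le_rfl hβ₀0.le (by linarith) le_rfl (by simpa using hc0.le)
  have h2 : ∀ s ∈ Finset.Icc 1 ⌊β₀ * Real.log V / c⌋₊, ∑ v ∈ nonzeroBall m V,
      smoothDivisorSum w J V (c * s / Real.log V) (V ^ (1 / s : ℝ)) (N v) ≤ E * X := by
    intro s hs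
    obtain ⟨hs1, hs2⟩ := Finset.mem_Icc.mp hs
    have hs1R : (1 : ℝ) ≤ s := by exact_mod_cast hs1
    have hs0 : (0 : ℝ) < s := by linarith
    have hs3 := (Nat.le_floor_iff (by positivity)).mp hs2
    refine hS V _ _ hV (by positivity) ?_ ?_ ?_ ?_
    · rw [div_le_iff₀ hL]
      rw [le_div_iff₀ hc0] at hs3
      linarith
    · exact Real.one_le_rpow (by linarith) (by positivity)
    · calc V ^ (1 / s : ℝ) ≤ V ^ (1 : ℝ) := by
            refine Real.rpow_le_rpow_of_exponent_le (by linarith) ?_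
            rw [div_le_iff₀ hs0]
            linarith
        _ = V := Real.rpow_one V
    · rw [Real.log_rpow hV0]
      field_simp
      exact le_rfl
  have h3 : ∑ v ∈ nonzeroBall m V,
      smoothDivisorSum w J V β₀ (min (Real.exp (c / β₀)) V) (N v) ≤ E * X := by
    -- The minimum with V guarantees y ≤ V even when V is smaller than e^(c/β₀).
    refine hS V _ _ hV hβ₀0.le le_rfl ?_ (min_le_right _ _) ?_
    · exact le_min (Real.one_le_exp (by positivity)) (by linarith)
    · have h4 : Real.log (min (Real.exp (c / β₀)) V) ≤ c / β₀ := by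
        refine (Real.log_le_log (by positivity) (min_le_left _ _)).trans ?_
        rw [Real.log_exp]
      calc _ ≤ β₀ * (c / β₀) := by gcongr
        _ = c := mul_div_cancel₀ _ hβ₀0.ne'
  calc ∑ v ∈ nonzeroBall m V, majorant w J (N v)
      ≤ ∑ v ∈ nonzeroBall m V, ((3 ^ J) ^ (2 * κ) * smoothDivisorSum w J V 0 V (N v) +
      ∑ s ∈ Finset.Icc 1 ⌊β₀ * Real.log V / c⌋₊, (3 ^ J) ^ κ * Real.exp (-s) *
        smoothDivisorSum w J V (c * s / Real.log V) (V ^ (1 / s : ℝ)) (N v) +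
      C * Real.exp c * smoothDivisorSum w J V β₀ (min (Real.exp (c / β₀)) V) (N v)) := by
        refine Finset.sum_le_sum fun v hv => ?_
        obtain ⟨hv0, hvV⟩ := hball V hV v hv
        exact majorant_le_sum_smoothDivisorSum hw hwJ hκ hβ₀0 hc hC hv0
          (hCn w hw hwJ _ hv0) hV hvV
    _ = (3 ^ J) ^ (2 * κ) * ∑ v ∈ nonzeroBall m V, smoothDivisorSum w J V 0 V (N v) +
      ∑ s ∈ Finset.Icc 1 ⌊β₀ * Real.log V / c⌋₊, (3 ^ J) ^ κ * Real.exp (-s) *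
        ∑ v ∈ nonzeroBall m V,
          smoothDivisorSum w J V (c * s / Real.log V) (V ^ (1 / s : ℝ)) (N v) +
      C * Real.exp c * ∑ v ∈ nonzeroBall m V,
        smoothDivisorSum w J V β₀ (min (Real.exp (c / β₀)) V) (N v) := by
        rw [Finset.sum_add_distrib, Finset.sum_add_distrib, Finset.sum_comm]
        simp_rw [Finset.mul_sum]
    _ ≤ (3 ^ J) ^ (2 * κ) * (E * X) +
      ∑ s ∈ Finset.Icc 1 ⌊β₀ * Real.log V / c⌋₊, (3 ^ J) ^ κ * Real.exp (-s) * (E * X) +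
      C * Real.exp c * (E * X) := by
        gcongr with s hs
        exact h2 s hs
    _ ≤ (3 ^ J) ^ (2 * κ) * (E * X) + (3 ^ J) ^ κ * (∑' s : ℕ, Real.exp (-s)) * (E * X) +
      C * Real.exp c * (E * X) := by
        gcongr
        rw [← Finset.sum_mul, ← Finset.mul_sum]
        gcongr
        exact hsum.sum_le_tsum _ fun s _ => (Real.exp_pos _).le
    _ = _ := by ring

end NormFormSum

/-! ### Arithmetic of the incomplete norm form. -/

namespace NormFormSum

section

variable {K : Type*} [Field K]

theorem intCast_mem_iff_dvd {P : Ideal (𝓞 K)} (hP : P.IsPrime) {p : ℕ} (hp : p.Prime)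
    (hpP : (p : 𝓞 K) ∈ P) (n : ℤ) : (n : 𝓞 K) ∈ P ↔ (p : ℤ) ∣ n := by
  constructor
  · intro hn
    by_contra hpn
    have hc : IsCoprime (p : ℤ) n := (Nat.prime_iff_prime_int.mp hp).coprime_iff_not_dvd.mpr hpn
    obtain ⟨a, b, hab⟩ := hc
    refine hP.ne_top ((Ideal.eq_top_iff_one _).mpr ?_)
    have h1 : ((a * p + b * n : ℤ) : 𝓞 K) = 1 := by rw [hab]; simp
    rw [← h1]
    push_cast
    exact P.add_mem (P.mul_mem_left _ hpP) (P.mul_mem_left _ hn)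
  · rintro ⟨c, rfl⟩
    push_cast
    exact P.mul_mem_right _ hpP

variable {k : ℕ} (ω : Module.Basis (Fin k) ℤ (𝓞 K))

theorem toInteger_add (v w : Fin (k - 1) → ℤ) :
    toInteger ω (v + w) = toInteger ω v + toInteger ω w := by
  simp [toInteger, add_smul, Finset.sum_add_distrib]

theorem toInteger_sub (v w : Fin (k - 1) → ℤ) :
    toInteger ω (v - w) = toInteger ω v - toInteger ω w := by
  simp [toInteger, sub_smul, Finset.sum_sub_distrib]

theorem toInteger_single (i : Fin (k - 1)) (a : ℤ) :
    toInteger ω (Pi.single i a) = a * ω (Fin.castLE (Nat.sub_le k 1) i) := by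
  rw [toInteger, Finset.sum_eq_single i]
  · simp
  · intro j _ hj
    simp [hj]
  · simp

theorem exists_toInteger_sub_eq {d : ℤ} {v w : Fin (k - 1) → ℤ} (h : ∀ i, d ∣ v i - w i) :
    ∃ z : 𝓞 K, toInteger ω v - toInteger ω w = d * z := by
  choose c hc using h
  refine ⟨toInteger ω c, ?_⟩
  rw [← toInteger_sub, toInteger, toInteger, Finset.mul_sum]
  refine Finset.sum_congr rfl fun i _ => ?_
  rw [Pi.sub_apply, hc i, zsmul_eq_mul, zsmul_eq_mul]
  push_cast
  ring

theorem toInteger_ne_zero {v : Fin (k - 1) → ℤ} (hv : v ≠ 0) : toInteger ω v ≠ 0 := by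
  intro h
  have hli := ω.linearIndependent.comp _ (Fin.castLE_injective (Nat.sub_le k 1))
  exact hv (funext fun i => Fintype.linearIndependent_iff.mp hli v h i)

theorem dvd_of_intCast_dvd {i : Fin k} (hω : ω i = 1) {d n : ℤ}
    (h : (d : 𝓞 K) ∣ (n : 𝓞 K)) : d ∣ n := by
  obtain ⟨z, hz⟩ := h
  have h1 : n • ω i = d • z := by rw [hω]; simpa using hz
  have h2 := congrArg (fun x => ω.repr x i) h1
  simp only [map_zsmul, Module.Basis.repr_self, Finsupp.smul_apply, Finsupp.single_eq_same,
    smul_eq_mul, mul_one] at h2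
  exact ⟨_, h2⟩

variable [NumberField K]

theorem smul_intCast_ringOfIntegers (σ : K ≃ₐ[ℚ] K) (n : ℤ) : σ • (n : 𝓞 K) = n :=
  map_intCast (MulSemiringAction.toRingHom (K ≃ₐ[ℚ] K) (𝓞 K) σ) n

theorem intCast_norm_eq_prod_smul [IsGalois ℚ K] (x : 𝓞 K) :
    ((Algebra.norm ℤ x : ℤ) : 𝓞 K) = ∏ σ : K ≃ₐ[ℚ] K, σ • x := by
  apply RingOfIntegers.coe_injective
  have h := Algebra.norm_eq_prod_automorphisms ℚ (x : K)
  rw [← Algebra.coe_norm_int] at h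
  rw [map_prod, map_intCast]
  rw [eq_ratCast, Rat.cast_intCast] at h
  exact h

theorem exists_isPrime_natCast_mem {p : ℕ} (hp : p.Prime) :
    ∃ P : Ideal (𝓞 K), P.IsPrime ∧ P ≠ ⊥ ∧ (p : 𝓞 K) ∈ P := by
  have hnu : ¬ IsUnit (p : 𝓞 K) := by
    intro h
    have h1 := h.map (Algebra.norm ℤ)
    rw [show (p : 𝓞 K) = algebraMap ℤ (𝓞 K) p by simp, Algebra.norm_algebraMap] at h1
    have h2 : IsUnit (p : ℤ) := (isUnit_pow_iff Module.finrank_pos.ne').mp h1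
    exact hp.one_lt.ne' (by simpa using Int.isUnit_iff_natAbs_eq.mp h2)
  obtain ⟨P, hP, hpP⟩ := exists_max_ideal_of_mem_nonunits hnu
  refine ⟨P, hP.isPrime, ?_, hpP⟩
  rintro rfl
  exact hp.ne_zero (by simpa using hpP)

variable [IsGalois ℚ K]

/-- Conjugates of vectors congruent modulo d are congruent modulo d𝓞, hence so are the norms. As 1
is a basis element, divisibility of an integer by d in 𝓞 descends to ℤ. -/
theorem incompleteNorm_dvdPeriodic {i : Fin k} (hω : ω i = 1) :
    DvdPeriodic (incompleteNorm ω) := by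
  intro d v w h hd
  obtain ⟨z, hz⟩ := exists_toInteger_sub_eq ω h
  unfold incompleteNorm at hd ⊢
  rw [← Int.natCast_dvd] at hd ⊢
  have h1 : (((d : ℤ) : 𝓞 K)) ∣ ((Algebra.norm ℤ (toInteger ω v) -
      Algebra.norm ℤ (toInteger ω w) : ℤ) : 𝓞 K) := by
    push_cast
    rw [intCast_norm_eq_prod_smul, intCast_norm_eq_prod_smul, ← Ideal.mem_span_singleton,
      ← Ideal.Quotient.eq, map_prod, map_prod]
    refine Finset.prod_congr rfl fun σ _ => ?_
    rw [Ideal.Quotient.eq, ← smul_sub, hz, smul_mul', smul_intCast_ringOfIntegers,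
      Ideal.mem_span_singleton]
    simp
  have h2 := dvd_of_intCast_dvd ω hω h1
  have h3 := dvd_sub hd h2
  simpa using h3

/-- Otherwise k - 1 independent elements would lie in the fixed field of σ, whose degree is at most
k/2; this is impossible for k ≥ 3. -/
theorem exists_smul_ne {σ : K ≃ₐ[ℚ] K} (hk : 3 ≤ k) (hdeg : Module.finrank ℚ K = k)
    (hσ : σ ≠ 1) : ∃ i : Fin (k - 1), σ • ω (Fin.castLE (Nat.sub_le k 1) i) ≠
      ω (Fin.castLE (Nat.sub_le k 1) i) := by
  by_contra! h
  set H := Subgroup.zpowers σ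
  set F := IntermediateField.fixedField H
  have hF : ∀ i : Fin (k - 1), (ω (Fin.castLE (Nat.sub_le k 1) i) : K) ∈ F := fun i => by
    rw [IntermediateField.mem_fixedField_iff]
    intro τ hτ
    obtain ⟨n, rfl⟩ := Subgroup.mem_zpowers_iff.mp hτ
    have h1 : σ ∈ MulAction.stabilizer (K ≃ₐ[ℚ] K) (ω (Fin.castLE (Nat.sub_le k 1) i)) := h i
    have h2 := Subgroup.zpow_mem _ h1 n
    exact congrArg (algebraMap (𝓞 K) K) h2
  have hli : LinearIndependent ℚ
      fun i : Fin (k - 1) => (⟨(ω (Fin.castLE (Nat.sub_le k 1) i) : K), hF i⟩ : F) := by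
    have h1 := ω.linearIndependent.comp _ (Fin.castLE_injective (Nat.sub_le k 1))
    have h2 := h1.map' (Algebra.linearMap (𝓞 K) K |>.restrictScalars ℤ)
      (LinearMap.ker_eq_bot.mpr RingOfIntegers.coe_injective)
    have h3 := (LinearIndependent.iff_fractionRing ℤ ℚ).mp h2
    exact LinearIndependent.of_comp F.val.toLinearMap h3
  have h1 := hli.fintype_card_le_finrank
  rw [Fintype.card_fin] at h1
  have h2 : Module.finrank F K = Nat.card H := IntermediateField.finrank_fixedField_eq_card H
  have h3 := Module.finrank_mul_finrank ℚ F K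
  have h4 : 2 ≤ Nat.card H := by
    have : Nat.card H ≠ 1 := by
      rw [Ne, Subgroup.card_eq_one, Subgroup.zpowers_eq_bot]
      exact hσ
    have : 0 < Nat.card H := Nat.card_pos
    omega
  rw [h2, hdeg] at h3
  have h5 := Nat.mul_le_mul_left (Module.finrank ℚ F) h4
  omega

/-- D is the norm of the product of nonzero differences σω_i - ω_i over σ ≠ 1, with i depending on
σ. If σω_i - τω_i lay in P for the i attached to τ⁻¹σ, then P would contain a conjugate of that
product, forcing p ∣ D. -/
theorem exists_forall_exists_smul_sub_smul_notMem (hk : 3 ≤ k)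
    (hdeg : Module.finrank ℚ K = k) : ∃ D : ℕ, D ≠ 0 ∧ ∀ p : ℕ, p.Prime → ¬ p ∣ D →
      ∀ P : Ideal (𝓞 K), P.IsPrime → (p : 𝓞 K) ∈ P → ∀ σ τ : K ≃ₐ[ℚ] K, σ ≠ τ →
        ∃ i : Fin (k - 1), σ • ω (Fin.castLE (Nat.sub_le k 1) i) -
          τ • ω (Fin.castLE (Nat.sub_le k 1) i) ∉ P := by
  classical
  have h := fun (σ : K ≃ₐ[ℚ] K) (hσ : σ ≠ 1) => exists_smul_ne ω hk hdeg hσ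
  have : Nonempty (Fin (k - 1)) := ⟨⟨0, by omega⟩⟩
  choose! i hi using h
  set f : (K ≃ₐ[ℚ] K) → 𝓞 K := fun σ => σ • ω (Fin.castLE (Nat.sub_le k 1) (i σ)) -
    ω (Fin.castLE (Nat.sub_le k 1) (i σ)) with hf
  set Δ : 𝓞 K := ∏ σ ∈ Finset.univ.erase (1 : K ≃ₐ[ℚ] K), f σ with hΔ
  have hΔ0 : Δ ≠ 0 := Finset.prod_ne_zero_iff.mpr fun σ hσ =>
    sub_ne_zero.mpr (hi σ (Finset.ne_of_mem_erase hσ))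
  refine ⟨(Algebra.norm ℤ Δ).natAbs, ?_, ?_⟩
  · rw [Int.natAbs_ne_zero]
    exact Algebra.norm_ne_zero_iff.mpr hΔ0
  · intro p hp hpD P hP hpP σ τ hστ
    refine ⟨i (τ⁻¹ * σ), fun hmem => hpD ?_⟩
    rw [← Int.natCast_dvd, ← intCast_mem_iff_dvd hP hp hpP, intCast_norm_eq_prod_smul]
    have h1 : τ⁻¹ * σ ∈ Finset.univ.erase (1 : K ≃ₐ[ℚ] K) :=
      Finset.mem_erase.mpr ⟨fun h => hστ (inv_mul_eq_one.mp h).symm, Finset.mem_univ _⟩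
    have h2 : τ • f (τ⁻¹ * σ) ∈ P := by
      simpa only [hf, smul_sub, ← mul_smul, mul_inv_cancel_left] using hmem
    have h3 : f (τ⁻¹ * σ) ∣ Δ := Finset.dvd_prod_of_mem f h1
    obtain ⟨c, hc⟩ := h3
    have h4 : τ • Δ ∈ P := by
      rw [hc, smul_mul']
      exact P.mul_mem_right _ h2
    exact Ideal.mem_of_dvd _ (Finset.dvd_prod_of_mem (fun τ : K ≃ₐ[ℚ] K => τ • Δ)
      (Finset.mem_univ τ)) h4

theorem exists_incompleteNorm_le (hdeg : Module.finrank ℚ K = k) (hk : 3 ≤ k) :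
    ∃ κ : ℕ, 0 < κ ∧ ∀ V : ℝ, 2 ≤ V → ∀ v ∈ nonzeroBall (k - 1) V,
      incompleteNorm ω v ≠ 0 ∧ (incompleteNorm ω v : ℝ) ≤ V ^ κ := by
  set S : ℝ := ∑ i : Fin (k - 1), ∑ φ : K →ₐ[ℚ] ℂ,
    ‖φ (ω (Fin.castLE (Nat.sub_le k 1) i) : K)‖ with hS
  obtain ⟨t, ht⟩ := pow_unbounded_of_one_lt S (one_lt_two)
  -- Each of the k embeddings is at most V·S ≤ V^(t+1), as S < 2^t ≤ V^t.
  refine ⟨(t + 1) * k, by positivity, fun V hV v hv => ?_⟩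
  obtain ⟨hv0, hvV⟩ := mem_nonzeroBall.mp hv
  refine ⟨Int.natAbs_ne_zero.mpr (Algebra.norm_ne_zero_iff.mpr (toInteger_ne_zero ω hv0)), ?_⟩
  have hvi : ∀ i, |(v i : ℝ)| ≤ V := fun i =>
    (PiLp.norm_apply_le (WithLp.toLp 2 (fun i => (v i : ℝ))) i).trans hvV
  have hφ : ∀ φ : K →ₐ[ℚ] ℂ, ‖φ (toInteger ω v : K)‖ ≤ V ^ (t + 1) := fun φ => by
    have h1 : φ (toInteger ω v : K) =
        ∑ i, (v i : ℂ) * φ (ω (Fin.castLE (Nat.sub_le k 1) i) : K) := by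
      simp [toInteger, map_sum]
    rw [h1]
    calc _ ≤ ∑ i, ‖(v i : ℂ) * φ (ω (Fin.castLE (Nat.sub_le k 1) i) : K)‖ := norm_sum_le _ _
      _ ≤ ∑ i, V * ∑ φ : K →ₐ[ℚ] ℂ, ‖φ (ω (Fin.castLE (Nat.sub_le k 1) i) : K)‖ := by
          refine Finset.sum_le_sum fun i _ => ?_
          rw [norm_mul]
          refine mul_le_mul ?_ ?_ (norm_nonneg _) (by linarith)
          · rw [Complex.norm_intCast]; exact hvi i
          · exact Finset.single_le_sum
              (f := fun φ : K →ₐ[ℚ] ℂ => ‖φ (ω (Fin.castLE (Nat.sub_le k 1) i) : K)‖)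
              (fun _ _ => norm_nonneg _) (Finset.mem_univ φ)
      _ = V * S := by rw [← Finset.mul_sum]
      _ ≤ V * V ^ t := by
          have : (2 : ℝ) ^ t ≤ V ^ t := by gcongr
          gcongr
          linarith
      _ = V ^ (t + 1) := by ring
  have hnorm := Algebra.norm_eq_prod_embeddings ℚ ℂ (toInteger ω v : K)
  rw [← Algebra.coe_norm_int] at hnorm
  have h2 : (incompleteNorm ω v : ℝ) = ‖∏ φ : K →ₐ[ℚ] ℂ, φ (toInteger ω v : K)‖ := by
    rw [← hnorm, incompleteNorm, Nat.cast_natAbs]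
    simp
  rw [h2, norm_prod, pow_mul]
  refine (Finset.prod_le_prod (fun _ _ => norm_nonneg _) fun φ _ => hφ φ).trans (le_of_eq ?_)
  rw [Finset.prod_const, Finset.card_univ, AlgHom.card, hdeg]

end

end NormFormSum

/-! ### Local densities of the norm form. -/

namespace NormFormSum

theorem density_le_one {m d : ℕ} [NeZero d] (Q : (Fin m → ℤ) → Prop) : density d Q ≤ 1 := by
  have h := density_le_of_packing (d := d) (Q := Q) (τ := Unit) (fun _ _ => 0)
    fun _ _ _ _ _ _ _ => rfl
  simpa using h

theorem natCast_eq_of_dvd_sub {n a b : ℕ} (ha : a < n) (hb : b < n)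
    (h : (n : ℤ) ∣ (a : ℤ) - b) : a = b := by
  have h1 := Int.eq_zero_of_abs_lt_dvd h (by rw [abs_lt]; omega)
  omega

section

variable {K : Type*} [Field K] [NumberField K] {k : ℕ}
  (ω : Module.Basis (Fin k) ℤ (𝓞 K))

theorem smul_toInteger_add_sub {d : ℕ} {v w s t : Fin (k - 1) → ℤ} (σ : K ≃ₐ[ℚ] K)
    (h : ∀ i, (d : ℤ) ∣ (v i + s i) - (w i + t i)) : ∃ z : 𝓞 K,
      σ • toInteger ω s - σ • toInteger ω t =
        σ • toInteger ω w - σ • toInteger ω v + d * z := by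
  obtain ⟨z, hz⟩ := exists_toInteger_sub_eq ω (v := v + s) (w := w + t) h
  refine ⟨σ • z, ?_⟩
  rw [toInteger_add, toInteger_add] at hz
  have h1 := congrArg (σ • ·) hz
  simp only [smul_sub, smul_add, smul_mul', Int.cast_natCast] at h1
  rw [← Int.cast_natCast, smul_intCast_ringOfIntegers, Int.cast_natCast] at h1
  linear_combination h1

theorem smul_toInteger_single_intCast {i₀ : Fin (k - 1)}
    (hω : ω (Fin.castLE (Nat.sub_le k 1) i₀) = 1) (σ : K ≃ₐ[ℚ] K) (a : ℤ) :
    σ • toInteger ω (Pi.single i₀ a) = a := by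
  rw [toInteger_single, hω, mul_one, smul_intCast_ringOfIntegers]

theorem density_smul_toInteger_mem_le {i₀ : Fin (k - 1)}
    (hω : ω (Fin.castLE (Nat.sub_le k 1) i₀) = 1) {P : Ideal (𝓞 K)} (hP : P.IsPrime) {p : ℕ} (hp : p.Prime)
    (hpP : (p : 𝓞 K) ∈ P) (σ : K ≃ₐ[ℚ] K) :
    density p (fun v => σ • toInteger ω v ∈ P) ≤ 1 / p := by
  have : NeZero p := ⟨hp.ne_zero⟩
  have h := density_le_of_packing (d := p) (Q := fun v => σ • toInteger ω v ∈ P) (τ := Fin p)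
    (fun a => Pi.single i₀ ((a : ℕ) : ℤ)) ?_
  · simpa using h
  · intro v w a b hv hw hd
    obtain ⟨z, hz⟩ := smul_toInteger_add_sub ω σ hd
    rw [smul_toInteger_single_intCast ω hω, smul_toInteger_single_intCast ω hω] at hz
    have h1 : (((a : ℕ) - (b : ℕ) : ℤ) : 𝓞 K) ∈ P := by
      rw [Int.cast_sub, hz]
      exact P.add_mem (P.sub_mem hw hv) (P.mul_mem_right _ hpP)
    rw [intCast_mem_iff_dvd hP hp hpP] at h1
    exact Fin.ext (natCast_eq_of_dvd_sub a.2 b.2 h1)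

/-- Translate by a in the first coordinate and b in the i-th. Both conjugates see the shift a +
b·(conjugate of ω_i), so subtracting determines b modulo p, and then a. -/
theorem density_smul_toInteger_mem_and_mem_le {P : Ideal (𝓞 K)} (hP : P.IsPrime) {p : ℕ}
    (hp : p.Prime) (hpP : (p : 𝓞 K) ∈ P) {d : ℕ} [NeZero d] (hpd : p ∣ d) {σ τ : K ≃ₐ[ℚ] K}
    {i : Fin (k - 1)} (hi : σ • ω (Fin.castLE (Nat.sub_le k 1) i) -
      τ • ω (Fin.castLE (Nat.sub_le k 1) i) ∉ P)
    {i₀ : Fin (k - 1)} (hω : ω (Fin.castLE (Nat.sub_le k 1) i₀) = 1) :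
    density d (fun v => σ • toInteger ω v ∈ P ∧ τ • toInteger ω v ∈ P) ≤ 1 / (p : ℝ) ^ 2 := by
  have : NeZero p := ⟨hp.ne_zero⟩
  have hdP : (d : 𝓞 K) ∈ P := by
    obtain ⟨c, rfl⟩ := hpd
    push_cast
    exact P.mul_mem_right _ hpP
  have h := density_le_of_packing (d := d)
    (Q := fun v => σ • toInteger ω v ∈ P ∧ τ • toInteger ω v ∈ P) (τ := Fin p × Fin p)
    (fun a => Pi.single i₀ ((a.1 : ℕ) : ℤ) + Pi.single i ((a.2 : ℕ) : ℤ)) ?_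
  · refine h.trans (le_of_eq ?_)
    rw [Fintype.card_prod, Fintype.card_fin]
    push_cast
    ring
  · rintro v w ⟨a, a'⟩ ⟨b, b'⟩ ⟨hvσ, hvτ⟩ ⟨hwσ, hwτ⟩ hd
    have key : ∀ ρ : K ≃ₐ[ℚ] K, ρ • toInteger ω v ∈ P → ρ • toInteger ω w ∈ P →
        (((a : ℕ) - (b : ℕ) : ℤ) : 𝓞 K) + (((a' : ℕ) - (b' : ℕ) : ℤ) : 𝓞 K) *
          ρ • ω (Fin.castLE (Nat.sub_le k 1) i) ∈ P := by
      intro ρ hv hw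
      obtain ⟨z, hz⟩ := smul_toInteger_add_sub ω ρ hd
      simp only [toInteger_add, smul_add] at hz
      rw [smul_toInteger_single_intCast ω hω, smul_toInteger_single_intCast ω hω,
        toInteger_single, toInteger_single, smul_mul', smul_mul', smul_intCast_ringOfIntegers,
        smul_intCast_ringOfIntegers] at hz
      have : (((a : ℕ) - (b : ℕ) : ℤ) : 𝓞 K) + (((a' : ℕ) - (b' : ℕ) : ℤ) : 𝓞 K) *
          ρ • ω (Fin.castLE (Nat.sub_le k 1) i) =
          ρ • toInteger ω w - ρ • toInteger ω v + d * z := by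
        rw [← hz]
        push_cast
        ring
      rw [this]
      exact P.add_mem (P.sub_mem hw hv) (P.mul_mem_right _ hdP)
    have h1 := key σ hvσ hwσ
    have h2 := key τ hvτ hwτ
    have h3 : (((a' : ℕ) - (b' : ℕ) : ℤ) : 𝓞 K) ∈ P := by
      have h4 := P.sub_mem h1 h2
      rw [add_sub_add_left_eq_sub, ← mul_sub] at h4
      exact (hP.mem_or_mem h4).resolve_right hi
    have h4 : (((a : ℕ) - (b : ℕ) : ℤ) : 𝓞 K) ∈ P := by
      have h5 := P.sub_mem h1 (P.mul_mem_right (σ • ω (Fin.castLE (Nat.sub_le k 1) i)) h3)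
      rwa [add_sub_cancel_right] at h5
    rw [intCast_mem_iff_dvd hP hp hpP] at h3 h4
    exact Prod.ext (Fin.ext (natCast_eq_of_dvd_sub a.2 b.2 h4))
      (Fin.ext (natCast_eq_of_dvd_sub a'.2 b'.2 h3))

variable [IsGalois ℚ K]

theorem exists_smul_toInteger_mem {P : Ideal (𝓞 K)} (hP : P.IsPrime) {p : ℕ} (hp : p.Prime)
    (hpP : (p : 𝓞 K) ∈ P) {v : Fin (k - 1) → ℤ} (h : p ∣ incompleteNorm ω v) :
    ∃ σ : K ≃ₐ[ℚ] K, σ • toInteger ω v ∈ P := by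
  rw [incompleteNorm, ← Int.natCast_dvd, ← intCast_mem_iff_dvd hP hp hpP,
    intCast_norm_eq_prod_smul, hP.prod_mem_iff] at h
  obtain ⟨σ, -, hσ⟩ := h
  exact ⟨σ, hσ⟩

variable {i₀ : Fin (k - 1)} (hω : ω (Fin.castLE (Nat.sub_le k 1) i₀) = 1)

include hω in
theorem dvdDensity_prime_le (hdeg : Module.finrank ℚ K = k) {p : ℕ} (hp : p.Prime) :
    dvdDensity (incompleteNorm ω) p ≤ k / p := by
  have : NeZero p := ⟨hp.ne_zero⟩
  obtain ⟨P, hP, -, hpP⟩ := exists_isPrime_natCast_mem (K := K) hp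
  refine (density_le_sum Finset.univ (fun (σ : K ≃ₐ[ℚ] K) v => σ • toInteger ω v ∈ P)
    fun v hv => ?_).trans ?_
  · obtain ⟨σ, hσ⟩ := exists_smul_toInteger_mem ω hP hp hpP hv
    exact ⟨σ, Finset.mem_univ σ, hσ⟩
  · refine (Finset.sum_le_sum fun σ _ => density_smul_toInteger_mem_le ω hω hP hp hpP σ).trans
      (le_of_eq ?_)
    rw [Finset.sum_const, Finset.card_univ, ← Nat.card_eq_fintype_card,
      IsGalois.card_aut_eq_finrank, hdeg, nsmul_eq_mul]
    ring

-- If p^α divides the norm, the P-adically smallest conjugate x has w(x)^k ≤ w(p)^α. Distinct shifts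
-- below p^⌈α/k⌉ differ by an integer p^j u with p ∤ u and jk < α, too large P-adically to connect
-- two such x.
include hω in
theorem dvdDensity_prime_pow_le_rpow (hk : 0 < k) (hdeg : Module.finrank ℚ K = k) {p : ℕ}
    (hp : p.Prime) (α : ℕ) :
    dvdDensity (incompleteNorm ω) (p ^ α) ≤ k * (p : ℝ) ^ (-((1 / k : ℝ) * α)) := by
  have : NeZero (p ^ α) := ⟨pow_ne_zero _ hp.ne_zero⟩
  have hkR : (0 : ℝ) < k := by exact_mod_cast hk
  obtain ⟨P, hP, hPbot, hpP⟩ := exists_isPrime_natCast_mem (K := K) hp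
  let w := (IsDedekindDomain.HeightOneSpectrum.mk P hP hPbot).intValuation
  have hw1 : ∀ x, w x ≤ 1 := IsDedekindDomain.HeightOneSpectrum.intValuation_le_one _
  have hwmem : ∀ x, w x < 1 ↔ x ∈ P :=
    IsDedekindDomain.HeightOneSpectrum.intValuation_lt_one_iff_mem _
  have hwp : w (p : 𝓞 K) < 1 := (hwmem _).mpr hpP
  have hwp0 : 0 < w (p : 𝓞 K) := by
    refine zero_lt_iff.mpr (IsDedekindDomain.HeightOneSpectrum.intValuation_ne_zero _ _ ?_)
    exact_mod_cast hp.ne_zero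
  have hcard : (Finset.univ : Finset (K ≃ₐ[ℚ] K)).card = k := by
    rw [Finset.card_univ, ← Nat.card_eq_fintype_card, IsGalois.card_aut_eq_finrank, hdeg]
  set r : ℕ := ⌈(α : ℝ) / k⌉₊ with hr
  have hone : ∀ σ : K ≃ₐ[ℚ] K, density (p ^ α)
      (fun v => w (σ • toInteger ω v) ^ k ≤ w (p : 𝓞 K) ^ α) ≤ (p : ℝ) ^ (-((1 / k : ℝ) * α)) := by
    intro σ
    have : Nonempty (Fin (p ^ r)) := ⟨⟨0, pow_pos hp.pos r⟩⟩
    have h := density_le_of_packing (d := p ^ α)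
      (Q := fun v => w (σ • toInteger ω v) ^ k ≤ w (p : 𝓞 K) ^ α) (τ := Fin (p ^ r))
      (fun a => Pi.single i₀ ((a : ℕ) : ℤ)) ?_
    · refine h.trans ?_
      rw [Fintype.card_fin, Nat.cast_pow, one_div, ← Real.rpow_natCast,
        ← Real.rpow_neg (by positivity)]
      refine Real.rpow_le_rpow_of_exponent_le (by exact_mod_cast hp.one_le) ?_
      have : (α : ℝ) / k ≤ r := Nat.le_ceil _
      rw [neg_le_neg_iff]
      refine le_trans (le_of_eq ?_) this
      ring
    · intro v v' a b hv hv' hd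
      obtain ⟨z, hz⟩ := smul_toInteger_add_sub ω σ hd
      rw [smul_toInteger_single_intCast ω hω, smul_toInteger_single_intCast ω hω] at hz
      by_contra hab
      have hab' : ((a : ℕ) : ℤ) - (b : ℕ) ≠ 0 := fun h => hab (Fin.ext (by omega))
      obtain ⟨u, hu, hpu⟩ := (Int.finiteMultiplicity_iff (a := (p : ℤ)).mpr
        ⟨by simpa using hp.ne_one, hab'⟩).exists_eq_pow_mul_and_not_dvd
      set j := multiplicity (p : ℤ) (((a : ℕ) : ℤ) - (b : ℕ))
      have hjr : j < r := by
        by_contra! hrj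
        refine hab (Fin.ext (natCast_eq_of_dvd_sub a.2 b.2 ?_))
        rw [hu]
        push_cast
        exact (pow_dvd_pow _ hrj).mul_right _
      have hjk : j * k < α := by
        have := Nat.lt_ceil.mp hjr
        rw [lt_div_iff₀ hkR] at this
        exact_mod_cast this
      have hwu : w (u : 𝓞 K) = 1 := by
        refine le_antisymm (hw1 _) (not_lt.mp fun h => hpu ?_)
        rwa [hwmem, intCast_mem_iff_dvd hP hp hpP] at h
      have hwab : w ((((a : ℕ) : ℤ) : 𝓞 K) - ((b : ℕ) : ℤ)) ^ k = w (p : 𝓞 K) ^ (j * k) := by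
        rw [← Int.cast_sub, hu]
        push_cast
        rw [map_mul, map_pow, hwu, mul_one, pow_mul]
      have hlt : w (p : 𝓞 K) ^ α < w (p : 𝓞 K) ^ (j * k) :=
        pow_lt_pow_right_of_lt_one₀ hwp0 hwp hjk
      rw [← hwab, hz] at hlt
      refine absurd hlt (not_lt.mpr ?_)
      have hmax : ∀ x y : 𝓞 K, w x ^ k ≤ w (p : 𝓞 K) ^ α → w y ^ k ≤ w (p : 𝓞 K) ^ α →
          w (x + y) ^ k ≤ w (p : 𝓞 K) ^ α := fun x y hx hy => by
        rcases le_max_iff.mp (w.map_add x y) with h | h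
        · exact (pow_le_pow_left₀ zero_le h k).trans hx
        · exact (pow_le_pow_left₀ zero_le h k).trans hy
      refine hmax _ _ ?_ ?_
      · rw [sub_eq_add_neg]
        exact hmax _ _ hv' (by rwa [w.map_neg])
      · push_cast
        rw [map_mul, map_pow, mul_pow, ← pow_mul]
        calc _ ≤ w (p : 𝓞 K) ^ (α * k) * 1 := by
              gcongr
              exact pow_le_one₀ zero_le (hw1 z)
          _ = w (p : 𝓞 K) ^ (α * k) := mul_one _
          _ ≤ w (p : 𝓞 K) ^ α :=
              pow_le_pow_of_le_one zero_le hwp.le (Nat.le_mul_of_pos_right α hk)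
  refine (density_le_sum Finset.univ
    (fun (σ : K ≃ₐ[ℚ] K) v => w (σ • toInteger ω v) ^ k ≤ w (p : 𝓞 K) ^ α)
    fun v hv => ?_).trans ?_
  · obtain ⟨σ, -, hσ⟩ := Finset.exists_min_image Finset.univ
      (fun σ : K ≃ₐ[ℚ] K => w (σ • toInteger ω v)) Finset.univ_nonempty
    refine ⟨σ, Finset.mem_univ σ, ?_⟩
    have h1 := Finset.pow_card_le_prod Finset.univ
      (fun σ : K ≃ₐ[ℚ] K => w (σ • toInteger ω v)) _ hσ
    rw [hcard, ← map_prod, ← intCast_norm_eq_prod_smul] at h1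
    refine h1.trans ?_
    rw [incompleteNorm, ← Int.natCast_dvd] at hv
    obtain ⟨c, hc⟩ := hv
    rw [hc]
    push_cast
    rw [map_mul, map_pow]
    exact mul_le_of_le_one_right' (hw1 _)
  · refine (Finset.sum_le_sum fun σ _ => hone σ).trans (le_of_eq ?_)
    rw [Finset.sum_const, hcard, nsmul_eq_mul]

/-- A Hensel-type argument: a conjugate that alone lies in P behaves like a simple root, so at most
one of the p² shifts in the first coordinate keeps p² dividing the norm. -/
theorem density_sq_dvd_and_mem_le {P : Ideal (𝓞 K)} (hP : P.IsPrime) {p : ℕ}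
    (hp : p.Prime) (hpP : (p : 𝓞 K) ∈ P) {d : ℕ} [NeZero d] (hpd : p ^ 2 ∣ d) (σ : K ≃ₐ[ℚ] K)
    {i₀ : Fin (k - 1)} (hω : ω (Fin.castLE (Nat.sub_le k 1) i₀) = 1) :
    density d (fun v => p ^ 2 ∣ incompleteNorm ω v ∧ σ • toInteger ω v ∈ P ∧
      ∀ τ, τ ≠ σ → τ • toInteger ω v ∉ P) ≤ 1 / (p : ℝ) ^ 2 := by
  classical
  have : Nonempty (Fin (p ^ 2)) := ⟨⟨0, pow_pos hp.pos 2⟩⟩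
  have h := density_le_of_packing (d := d)
    (Q := fun v => p ^ 2 ∣ incompleteNorm ω v ∧ σ • toInteger ω v ∈ P ∧
      ∀ τ, τ ≠ σ → τ • toInteger ω v ∉ P) (τ := Fin (p ^ 2))
    (fun a => Pi.single i₀ ((a : ℕ) : ℤ)) ?_
  · simpa using h
  · rintro v w a b ⟨hv, hvσ, -⟩ ⟨hw, hwσ, hwτ⟩ hd
    obtain ⟨c, rfl⟩ := hpd
    have key : ∀ τ : K ≃ₐ[ℚ] K, ∃ z : 𝓞 K, τ • toInteger ω w = τ • toInteger ω v +
        (((a : ℕ) - (b : ℕ) : ℤ) : 𝓞 K) + (p : 𝓞 K) ^ 2 * z := fun τ => by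
      obtain ⟨z, hz⟩ := smul_toInteger_add_sub ω τ hd
      rw [smul_toInteger_single_intCast ω hω, smul_toInteger_single_intCast ω hω] at hz
      refine ⟨-(c * z), ?_⟩
      push_cast at hz ⊢
      linear_combination -hz
    have hdvd : (p : ℤ) ∣ ((a : ℕ) : ℤ) - (b : ℕ) := by
      obtain ⟨z, hz⟩ := key σ
      rw [← intCast_mem_iff_dvd hP hp hpP]
      have : (((a : ℕ) - (b : ℕ) : ℤ) : 𝓞 K) = σ • toInteger ω w - σ • toInteger ω v -
          (p : 𝓞 K) * (p * z) := by rw [hz]; ring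
      rw [this]
      exact P.sub_mem (P.sub_mem hwσ hvσ) (P.mul_mem_right _ hpP)
    obtain ⟨y, hy⟩ := hdvd
    rw [hy] at key
    push_cast at key
    have hnorm : ∀ v : Fin (k - 1) → ℤ, p ^ 2 ∣ incompleteNorm ω v → ∃ z : 𝓞 K,
        σ • toInteger ω v * ∏ τ ∈ Finset.univ.erase σ, τ • toInteger ω v =
          (p : 𝓞 K) ^ 2 * z := fun v hv => by
      rw [incompleteNorm, ← Int.natCast_dvd] at hv
      obtain ⟨z, hz⟩ := hv
      refine ⟨z, ?_⟩
      rw [Finset.mul_prod_erase _ (fun τ : K ≃ₐ[ℚ] K => τ • toInteger ω v) (Finset.mem_univ σ),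
        ← intCast_norm_eq_prod_smul, hz]
      push_cast
      ring
    obtain ⟨x, hx⟩ : ∃ x, ∏ τ ∈ Finset.univ.erase σ, τ • toInteger ω w -
        ∏ τ ∈ Finset.univ.erase σ, τ • toInteger ω v = (p : 𝓞 K) * x := by
      change (p : 𝓞 K) ∣ _
      rw [← Ideal.mem_span_singleton, ← Ideal.Quotient.eq, map_prod, map_prod]
      refine Finset.prod_congr rfl fun τ _ => ?_
      obtain ⟨z, hz⟩ := key τ
      rw [Ideal.Quotient.eq, Ideal.mem_span_singleton]
      exact ⟨y + p * z, by rw [hz]; ring⟩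
    obtain ⟨z₁, hz₁⟩ := hnorm v hv
    obtain ⟨z₂, hz₂⟩ := hnorm w hw
    obtain ⟨z, hz⟩ := key σ
    have hW : ∏ τ ∈ Finset.univ.erase σ, τ • toInteger ω w ∉ P := by
      rw [hP.prod_mem_iff]
      rintro ⟨τ, hτ, h⟩
      exact hwτ τ (Finset.ne_of_mem_erase hτ) h
    set U := ∏ τ ∈ Finset.univ.erase σ, τ • toInteger ω v
    set W := ∏ τ ∈ Finset.univ.erase σ, τ • toInteger ω w
    have hp0 : (p : 𝓞 K) ≠ 0 := by exact_mod_cast hp.ne_zero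
    -- The shift difference is py. Subtracting the two norms, with σw = σv + py + p²z and W - U =
    -- px, leaves a multiple of p that can be cancelled.
    have h1 : (y : 𝓞 K) * W = p * (z₂ - z₁ - z * W) - x * σ • toInteger ω v := by
      apply mul_left_cancel₀ hp0
      rw [hz] at hz₂
      linear_combination hz₂ - hz₁ - (σ • toInteger ω v) * hx
    have h2 : (y : 𝓞 K) ∈ P := by
      refine (hP.mem_or_mem (y := W) ?_).resolve_right hW
      rw [h1]
      exact P.sub_mem (P.mul_mem_right _ hpP) (P.mul_mem_left _ hvσ)
    rw [intCast_mem_iff_dvd hP hp hpP] at h2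
    refine Fin.ext (natCast_eq_of_dvd_sub a.2 b.2 ?_)
    rw [hy]
    push_cast
    rw [pow_two]
    exact mul_dvd_mul_left _ h2

-- Primes dividing D are covered by the trivial bound 1 ≤ D²/p². For the others either two distinct
-- conjugates lie in P (at most n² pairs) or exactly one does (n choices).
include hω in
theorem exists_dvdDensity_prime_pow_le_sq (hk : 3 ≤ k) (hdeg : Module.finrank ℚ K = k) :
    ∃ M : ℝ, 0 ≤ M ∧ ∀ p α : ℕ, p.Prime → 2 ≤ α →
      dvdDensity (incompleteNorm ω) (p ^ α) ≤ M / (p : ℝ) ^ 2 := by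
  classical
  obtain ⟨D, hD0, hD⟩ := exists_forall_exists_smul_sub_smul_notMem ω hk hdeg
  set n := Fintype.card (K ≃ₐ[ℚ] K)
  refine ⟨D ^ 2 + n ^ 2 + n, by positivity, fun p α hp hα => ?_⟩
  have hp0 : (0 : ℝ) < p := by exact_mod_cast hp.pos
  have : NeZero (p ^ α) := ⟨pow_ne_zero _ hp.ne_zero⟩
  by_cases hpD : p ∣ D
  · refine (density_le_one _).trans ?_
    rw [one_le_div (by positivity)]
    have h1 : (p : ℝ) ≤ D := by exact_mod_cast Nat.le_of_dvd (Nat.pos_of_ne_zero hD0) hpD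
    have h2 : (p : ℝ) ^ 2 ≤ D ^ 2 := by gcongr
    nlinarith [Nat.cast_nonneg (α := ℝ) n]
  obtain ⟨P, hP, -, hpP⟩ := exists_isPrime_natCast_mem (K := K) hp
  let R : (K ≃ₐ[ℚ] K) × (K ≃ₐ[ℚ] K) ⊕ (K ≃ₐ[ℚ] K) → (Fin (k - 1) → ℤ) → Prop :=
    Sum.elim (fun s v => s.1 ≠ s.2 ∧ s.1 • toInteger ω v ∈ P ∧ s.2 • toInteger ω v ∈ P)
      fun σ v => p ^ 2 ∣ incompleteNorm ω v ∧ σ • toInteger ω v ∈ P ∧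
        ∀ τ, τ ≠ σ → τ • toInteger ω v ∉ P
  have hR : ∀ s, density (p ^ α) (R s) ≤ 1 / (p : ℝ) ^ 2 := by
    rintro (⟨σ, τ⟩ | σ)
    · by_cases hστ : σ = τ
      · refine (density_mono (R := fun _ => False) fun v hv => hv.1 hστ).trans ?_
        have : residueSet (m := k - 1) (p ^ α) (fun _ => False) = ∅ := by
          ext x; simp [residueSet]
        rw [density, this]
        simp
      · obtain ⟨i, hi⟩ := hD p hp hpD P hP hpP σ τ hστ
        refine (density_mono fun v hv => hv.2).trans
          (density_smul_toInteger_mem_and_mem_le ω hP hp hpP (dvd_pow_self p (by omega)) hi hω)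
    · exact density_sq_dvd_and_mem_le ω hP hp hpP (pow_dvd_pow p hα) σ hω
  refine (density_le_sum Finset.univ R fun v hv => ?_).trans
    ((Finset.sum_le_sum fun s _ => hR s).trans ?_)
  · obtain ⟨σ, hσ⟩ := exists_smul_toInteger_mem ω hP hp hpP
      ((dvd_pow_self p (by omega : α ≠ 0)).trans hv)
    by_cases h : ∃ τ, τ ≠ σ ∧ τ • toInteger ω v ∈ P
    · obtain ⟨τ, hτσ, hτ⟩ := h
      exact ⟨Sum.inl (τ, σ), Finset.mem_univ _, hτσ, hτ, hσ⟩
    · push Not at h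
      exact ⟨Sum.inr σ, Finset.mem_univ _, (pow_dvd_pow p hα).trans hv, hσ, h⟩
  · rw [Finset.sum_const, Finset.card_univ, Fintype.card_sum, Fintype.card_prod, nsmul_eq_mul,
      mul_one_div]
    push_cast
    have : (0 : ℝ) ≤ (D : ℝ) ^ 2 := by positivity
    gcongr
    linarith

end

end NormFormSum

/-! ### Degree-one primes and the pole of the Dedekind zeta function. -/

namespace NormFormSum

open scoped Pointwise

section

variable {K : Type*} [Field K] [NumberField K]

theorem exists_intCast_sub_mem {P : Ideal (𝓞 K)} {p : ℕ} (hp : p.Prime) (hP : P.IsPrime)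
    (hpP : (p : 𝓞 K) ∈ P) (hN : Ideal.absNorm P = p) (x : 𝓞 K) : ∃ n : ℤ, x - n ∈ P := by
  have hcard : Nat.card (𝓞 K ⧸ P) = p := by
    rw [← hN, Ideal.absNorm_apply, Submodule.cardQuot_apply]
  have : Finite (𝓞 K ⧸ P) := Nat.finite_of_card_ne_zero (hcard ▸ hp.ne_zero)
  have hbij := (Nat.bijective_iff_injective_and_card
    (fun a : Fin p => Ideal.Quotient.mk P (((a : ℕ) : ℤ) : 𝓞 K))).mpr
    ⟨fun a b hab => by
      rw [Ideal.Quotient.eq, ← Int.cast_sub, intCast_mem_iff_dvd hP hp hpP] at hab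
      exact Fin.ext (natCast_eq_of_dvd_sub a.2 b.2 hab), by rw [hcard, Nat.card_fin]⟩
  obtain ⟨a, ha⟩ := hbij.2 (Ideal.Quotient.mk P x)
  exact ⟨((a : ℕ) : ℤ), Ideal.Quotient.eq.mp ha.symm⟩

/-- The conjugates σP are distinct: modulo the degree-one prime P every x is an integer n, so σP =
τP would put σx - τx = (σx - n) - (τx - n) in σP for all x. -/
theorem exists_finset_primes_absNorm_eq [IsGalois ℚ K] {p : ℕ} (hp : p.Prime)
    (hsplit : LiesBelowDegreeOne K p)
    (hgood : ∀ P : Ideal (𝓞 K), P.IsPrime → (p : 𝓞 K) ∈ P → ∀ σ τ : K ≃ₐ[ℚ] K, σ ≠ τ →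
      ∃ x : 𝓞 K, σ • x - τ • x ∉ P) :
    ∃ S : Finset (Ideal (𝓞 K)), S.card = Module.finrank ℚ K ∧
      ∀ P ∈ S, P.IsPrime ∧ Ideal.absNorm P = p := by
  classical
  obtain ⟨P, hP, hover, hdeg⟩ := hsplit
  have hN : Ideal.absNorm P = p := by rw [← Ideal.pow_inertiaDeg p P, hdeg, pow_one]
  have hpP : (p : 𝓞 K) ∈ P := hN ▸ Ideal.absNorm_mem P
  have hinj : Function.Injective fun σ : K ≃ₐ[ℚ] K => σ • P := by
    intro σ τ hστ
    simp only at hστ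
    by_contra hne
    have hpσ : (p : 𝓞 K) ∈ σ • P := by
      have h1 : σ • (((p : ℕ) : ℤ) : 𝓞 K) ∈ σ • P :=
        Ideal.smul_mem_pointwise_smul σ _ P (by simpa using hpP)
      rw [smul_intCast_ringOfIntegers] at h1
      simpa using h1
    obtain ⟨x, hx⟩ := hgood (σ • P) inferInstance hpσ σ τ hne
    obtain ⟨n, hn⟩ := exists_intCast_sub_mem hp hP hpP hN x
    have h1 : ∀ ρ : K ≃ₐ[ℚ] K, ρ • x - n ∈ ρ • P := fun ρ => by
      have h2 := Ideal.smul_mem_pointwise_smul ρ _ P hn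
      rwa [smul_sub, smul_intCast_ringOfIntegers] at h2
    refine hx ?_
    have h2 := (σ • P).sub_mem (h1 σ) (hστ ▸ h1 τ)
    rwa [sub_sub_sub_cancel_right] at h2
  refine ⟨Finset.univ.image fun σ : K ≃ₐ[ℚ] K => σ • P, ?_, ?_⟩
  · rw [Finset.card_image_of_injective _ hinj, Finset.card_univ, ← Nat.card_eq_fintype_card,
      IsGalois.card_aut_eq_finrank]
  · intro Q hQ
    obtain ⟨σ, -, rfl⟩ := Finset.mem_image.mp hQ
    have hQp : (σ • P).IsPrime := inferInstance
    have hQo : (σ • P).LiesOver (Ideal.span {(p : ℤ)}) := inferInstance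
    refine ⟨hQp, ?_⟩
    rw [← Ideal.pow_inertiaDeg p (σ • P), Ideal.inertiaDeg_smul, hdeg, pow_one]

/-- Expanding the product gives a sum of N(I)^(-s) over ideals I that are distinct by unique
factorisation, hence part of the Dirichlet series of ζ_K. -/
theorem prod_one_add_absNorm_le_norm_dedekindZeta {s : ℝ}
    (hs : dedekindZeta K s ≠ 0) (S : Finset (Ideal (𝓞 K)))
    (hS : ∀ P ∈ S, P.IsPrime ∧ P ≠ ⊥) :
    ∏ P ∈ S, (1 + ((Ideal.absNorm P : ℕ) : ℝ) ^ (-s)) ≤ ‖dedekindZeta K s‖ := by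
  classical
  let a : ℕ → ℕ := fun n => Nat.card {I : Ideal (𝓞 K) // Ideal.absNorm I = n}
  let g : ℕ → ℝ := fun n => if n = 0 then 0 else (a n : ℝ) * (n : ℝ) ^ (-s)
  have hg0 : ∀ n, 0 ≤ g n := fun n => by
    simp only [g]; split_ifs <;> positivity
  have hterm : ∀ n, LSeries.term (fun n => (a n : ℂ)) s n = ((g n : ℝ) : ℂ) := fun n => by
    rw [LSeries.term_def]
    simp only [g]
    split_ifs with h
    · simp
    · rw [Real.rpow_neg (by positivity), Complex.ofReal_mul, Complex.ofReal_inv,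
        Complex.ofReal_cpow (by positivity), div_eq_mul_inv]
      simp
  -- A divergent `LSeries` has the default value 0, so nonvanishing yields convergence.
  have hsum : LSeriesSummable (fun n => (a n : ℂ)) s := by
    by_contra h
    exact hs (LSeries.eq_zero_of_not_LSeriesSummable _ _ h)
  have hgsum : Summable g := by
    rw [← Complex.summable_ofReal]
    exact hsum.congr fun n => hterm n
  have hzeta : dedekindZeta K s = ((∑' n, g n : ℝ) : ℂ) := by
    rw [Complex.ofReal_tsum]
    exact tsum_congr hterm
  rw [hzeta, Complex.norm_real, Real.norm_of_nonneg (tsum_nonneg hg0), Finset.prod_one_add]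
  have hPprime : ∀ P ∈ S, Prime P := fun P hP => Ideal.prime_of_isPrime (hS P hP).2 (hS P hP).1
  have hinj : Set.InjOn (fun T : Finset (Ideal (𝓞 K)) => ∏ P ∈ T, P) (S.powerset : Set _) := by
    intro T hT U hU hTU
    have h1 : ∀ T ∈ S.powerset, UniqueFactorizationMonoid.normalizedFactors (∏ P ∈ T, P) = T.val := by
      intro T hT
      have h2 := UniqueFactorizationMonoid.normalizedFactors_prod_of_prime (m := T.val)
        fun P hP => hPprime P (Finset.mem_powerset.mp hT hP)
      rwa [Finset.prod_val] at h2
    apply Finset.val_injective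
    rw [← h1 T hT, ← h1 U hU]
    exact congrArg _ hTU
  set A := S.powerset.image fun T : Finset (Ideal (𝓞 K)) => ∏ P ∈ T, P with hA
  have h1 : ∑ T ∈ S.powerset, ∏ P ∈ T, ((Ideal.absNorm P : ℕ) : ℝ) ^ (-s) =
      ∑ I ∈ A, ((Ideal.absNorm I : ℕ) : ℝ) ^ (-s) := by
    rw [hA, Finset.sum_image hinj]
    refine Finset.sum_congr rfl fun T _ => ?_
    rw [map_prod, Nat.cast_prod, Real.finsetProd_rpow _ _ fun P _ => by positivity]
  rw [h1, ← Finset.sum_fiberwise_of_maps_to (t := A.image fun I => Ideal.absNorm I)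
    (g := fun I => Ideal.absNorm I) fun I hI => Finset.mem_image_of_mem _ hI]
  refine le_trans (Finset.sum_le_sum fun n hn => ?_) (hgsum.sum_le_tsum _ fun n _ => hg0 n)
  have hn0 : n ≠ 0 := by
    rintro rfl
    obtain ⟨I, hI, hI0⟩ := Finset.mem_image.mp hn
    obtain ⟨T, hT, rfl⟩ := Finset.mem_image.mp hI
    rw [Ideal.absNorm_eq_zero_iff, ← Ideal.zero_eq_bot, Finset.prod_eq_zero_iff] at hI0
    obtain ⟨P, hP, hP0⟩ := hI0
    exact (hS P (Finset.mem_powerset.mp hT hP)).2 hP0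
  have h2 : ∀ I ∈ A.filter fun I => Ideal.absNorm I = n,
      ((Ideal.absNorm I : ℕ) : ℝ) ^ (-s) = (n : ℝ) ^ (-s) := fun I hI => by
    rw [(Finset.mem_filter.mp hI).2]
  rw [Finset.sum_congr rfl h2, Finset.sum_const, nsmul_eq_mul]
  simp only [g, if_neg hn0]
  gcongr
  simp only [a]
  have hfin := Ideal.finite_setOfPred_absNorm_eq (S := 𝓞 K) n
  rw [← Nat.card_eq_finsetCard]
  have : Finite {I : Ideal (𝓞 K) // Ideal.absNorm I = n} := hfin
  exact Nat.card_le_card_of_injective (fun I => ⟨I.1, (Finset.mem_filter.mp I.2).2⟩)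
    fun I J h => Subtype.ext (Subtype.mk.inj h)

theorem exists_prod_one_add_absNorm_le : ∃ ε B : ℝ, 0 < ε ∧ 0 < B ∧ ∀ t : ℝ, 0 < t → t ≤ ε →
    ∀ S : Finset (Ideal (𝓞 K)), (∀ P ∈ S, P.IsPrime ∧ P ≠ ⊥) →
      ∏ P ∈ S, (1 + ((Ideal.absNorm P : ℕ) : ℝ) ^ (-(1 + t))) ≤ B / t := by
  have h := NumberField.tendsto_sub_one_mul_dedekindZeta_nhdsGT K
  have hρ := NumberField.dedekindZeta_residue_pos K
  set ρ := NumberField.dedekindZeta_residue K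
  have h1 : ∀ᶠ s : ℝ in nhdsWithin 1 (Set.Ioi 1), ‖((s : ℂ) - 1) * dedekindZeta K s‖ < 2 * ρ ∧
      0 < ‖((s : ℂ) - 1) * dedekindZeta K s‖ := by
    have h2 := h.norm
    rw [Complex.norm_real, Real.norm_of_nonneg hρ.le] at h2
    exact (h2.eventually_lt_const (by linarith)).and (h2.eventually_const_lt hρ)
  obtain ⟨u, hu, hsub⟩ := (mem_nhdsGT_iff_exists_Ioc_subset).mp h1
  rw [Set.mem_Ioi] at hu
  refine ⟨u - 1, 2 * ρ, by linarith, by positivity, fun t ht htu S hS => ?_⟩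
  obtain ⟨h2, h3⟩ := hsub (show 1 + t ∈ Set.Ioc 1 u from ⟨by linarith, by linarith⟩)
  have h4 : dedekindZeta K ((1 + t : ℝ) : ℂ) ≠ 0 := fun h0 => by
    rw [h0] at h3; simp at h3
  refine (prod_one_add_absNorm_le_norm_dedekindZeta h4 S hS).trans ?_
  rw [norm_mul, show (((1 + t : ℝ) : ℂ) - 1) = ((t : ℝ) : ℂ) by push_cast; ring,
    Complex.norm_real, Real.norm_of_nonneg ht.le] at h2
  rw [le_div_iff₀ ht]
  linarith

theorem exp_sub_sq_le_one_add {x : ℝ} (hx : 0 ≤ x) : Real.exp (x - x ^ 2) ≤ 1 + x := by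
  rw [← Real.le_log_iff_exp_le (by linarith)]
  refine le_trans ?_ (Real.one_sub_inv_le_log_of_pos (by linarith))
  have h1 : 1 - (1 + x)⁻¹ = x / (1 + x) := by field_simp; ring
  rw [h1, le_div_iff₀ (by linarith)]
  nlinarith [pow_nonneg hx 3]

theorem inv_sub_rpow_le {p t : ℝ} (hp : 1 ≤ p) :
    1 / p - p ^ (-(1 + t)) ≤ t * (Real.log p / p) := by
  have hp0 : 0 < p := by linarith
  have h1 : p ^ (-(1 + t)) = p⁻¹ * Real.exp (-(t * Real.log p)) := by
    rw [neg_add, Real.rpow_add hp0, Real.rpow_neg_one, Real.rpow_def_of_pos hp0]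
    congr 2
    ring
  have h2 := Real.add_one_le_exp (-(t * Real.log p))
  have h3 : 0 < p⁻¹ := by positivity
  rw [h1, one_div, div_eq_mul_inv]
  nlinarith

-- Compare 1/p with p^(-1-t), where t is of order 1/log V. The total change is at most t ∑ log p / p
-- = O(1), while the pole bounds the product at 1 + t by B/t ≪ log V.
open Classical in
theorem exists_exp_sum_liesBelowDegreeOne_le [IsGalois ℚ K] {k : ℕ}
    (ω : Module.Basis (Fin k) ℤ (𝓞 K)) (hk : 3 ≤ k) (hdeg : Module.finrank ℚ K = k) :
    ∃ C : ℝ, 0 < C ∧ ∀ V : ℝ, 2 ≤ V → ∀ n : ℕ, (n : ℝ) ≤ V + 1 →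
      Real.exp (∑ p ∈ n.primesBelow.filter (LiesBelowDegreeOne K), (k : ℝ) / p) ≤
        C * Real.log V := by
  obtain ⟨D, hD0, hD⟩ := exists_forall_exists_smul_sub_smul_notMem ω hk hdeg
  obtain ⟨ε, B, hε, hB, hprod⟩ := exists_prod_one_add_absNorm_le (K := K)
  have hz : Summable fun n : ℕ => 1 / (n : ℝ) ^ 2 := Real.summable_one_div_nat_pow.mpr one_lt_two
  set Z : ℝ := ∑' n : ℕ, 1 / (n : ℝ) ^ 2
  have hl2 : 0 < Real.log 2 := Real.log_pos one_lt_two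
  have hkR : (0 : ℝ) < k := by exact_mod_cast (by omega : 0 < k)
  refine ⟨B / (ε * Real.log 2) * Real.exp (k * Z + k * (4 * (ε * Real.log 2)) + k * D),
    by positivity, fun V hV n hn => ?_⟩
  have hL : Real.log 2 ≤ Real.log V := Real.log_le_log (by norm_num) hV
  have hL0 : 0 < Real.log V := by linarith
  -- The factor log 2 ensures t ≤ ε for every V ≥ 2.
  set t : ℝ := ε * Real.log 2 / Real.log V with ht
  have ht0 : 0 < t := by positivity
  have htε : t ≤ ε := by
    rw [ht, div_le_iff₀ hL0]
    gcongr
  have hlogn : t * (2 * Real.log n) ≤ 4 * (ε * Real.log 2) := by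
    have h1 : Real.log n ≤ 2 * Real.log V := by
      rcases Nat.eq_zero_or_pos n with rfl | hn0
      · simpa using hL0.le
      have h2 : Real.log n ≤ Real.log (2 * V) :=
        Real.log_le_log (by exact_mod_cast hn0) (by linarith)
      rw [Real.log_mul (by norm_num) (by linarith)] at h2
      linarith
    calc t * (2 * Real.log n) ≤ t * (2 * (2 * Real.log V)) := by gcongr
      _ = 4 * (ε * Real.log 2) := by rw [ht]; field_simp; ring
  set 𝒮 := n.primesBelow.filter (LiesBelowDegreeOne K) with h𝒮
  have h𝒮p : ∀ p ∈ 𝒮, p.Prime := fun p hp =>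
    (Nat.mem_primesBelow.mp (Finset.mem_filter.mp hp).1).2
  set 𝒢 := 𝒮.filter fun p => ¬ p ∣ D with h𝒢
  have hfam : ∀ p ∈ 𝒢, ∃ S : Finset (Ideal (𝓞 K)), S.card = k ∧
      ∀ P ∈ S, P.IsPrime ∧ Ideal.absNorm P = p := by
    intro p hp
    obtain ⟨hp1, hp2⟩ := Finset.mem_filter.mp hp
    have hpp := h𝒮p p hp1
    rw [← hdeg]
    refine exists_finset_primes_absNorm_eq hpp (Finset.mem_filter.mp hp1).2
      fun P hP hpP σ τ hστ => ?_
    obtain ⟨i, hi⟩ := hD p hpp hp2 P hP hpP σ τ hστ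
    exact ⟨_, hi⟩
  choose! S hScard hSP using hfam
  have hdisj : (𝒢 : Set ℕ).PairwiseDisjoint S := by
    intro p hp q hq hpq
    rw [Function.onFun, Finset.disjoint_left]
    intro P hPp hPq
    exact hpq ((hSP p hp P hPp).2.symm.trans (hSP q hq P hPq).2)
  have h1 : ∏ p ∈ 𝒢, (1 + (p : ℝ) ^ (-(1 + t))) ^ k ≤ B / t := by
    refine le_trans (le_of_eq ?_) (hprod t ht0 htε (𝒢.biUnion S) fun P hP => ?_)
    · rw [Finset.prod_biUnion hdisj]
      refine Finset.prod_congr rfl fun p hp => ?_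
      rw [← hScard p hp, ← Finset.prod_const]
      exact Finset.prod_congr rfl fun P hP => by rw [(hSP p hp P hP).2]
    · obtain ⟨p, hp, hPS⟩ := Finset.mem_biUnion.mp hP
      obtain ⟨hPp, hPN⟩ := hSP p hp P hPS
      refine ⟨hPp, ?_⟩
      rintro rfl
      rw [Ideal.absNorm_bot] at hPN
      exact (h𝒮p p (Finset.mem_filter.mp hp).1).ne_zero hPN.symm
  have h2 : Real.exp (∑ p ∈ 𝒢, (k : ℝ) * ((p : ℝ) ^ (-(1 + t)) - 1 / (p : ℝ) ^ 2)) ≤ B / t := by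
    refine le_trans ?_ h1
    rw [Real.exp_sum]
    refine Finset.prod_le_prod (fun p _ => (Real.exp_pos _).le) fun p hp => ?_
    have hp1 : (1 : ℝ) ≤ p := by
      exact_mod_cast (h𝒮p p (Finset.mem_filter.mp hp).1).one_le
    rw [Real.exp_nat_mul]
    refine pow_le_pow_left₀ (Real.exp_pos _).le ?_ k
    refine le_trans (Real.exp_le_exp.mpr ?_) (exp_sub_sq_le_one_add (by positivity))
    have h3 : ((p : ℝ) ^ (-(1 + t))) ^ 2 ≤ 1 / (p : ℝ) ^ 2 := by
      rw [one_div, ← inv_pow]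
      refine pow_le_pow_left₀ (by positivity) ?_ 2
      rw [← Real.rpow_neg_one]
      exact Real.rpow_le_rpow_of_exponent_le hp1 (by linarith)
    linarith
  have h3 : ∑ p ∈ 𝒮.filter (· ∣ D), (k : ℝ) / p ≤ k * D := by
    have h4 : (𝒮.filter (· ∣ D)).card ≤ D := by
      refine (Finset.card_le_card (t := Finset.Icc 1 D) fun p hp => ?_).trans (by simp)
      obtain ⟨hp1, hp2⟩ := Finset.mem_filter.mp hp
      exact Finset.mem_Icc.mpr ⟨(h𝒮p p hp1).one_le, Nat.le_of_dvd (Nat.pos_of_ne_zero hD0) hp2⟩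
    calc ∑ p ∈ 𝒮.filter (· ∣ D), (k : ℝ) / p ≤ ∑ p ∈ 𝒮.filter (· ∣ D), (k : ℝ) := by
          refine Finset.sum_le_sum fun p hp => div_le_self hkR.le ?_
          exact_mod_cast (h𝒮p p (Finset.mem_filter.mp hp).1).one_le
      _ = (𝒮.filter (· ∣ D)).card * k := by rw [Finset.sum_const, nsmul_eq_mul]
      _ ≤ D * k := by gcongr
      _ = k * D := mul_comm _ _
  have h4 : ∑ p ∈ 𝒢, (k : ℝ) / p ≤
      ∑ p ∈ 𝒢, (k : ℝ) * ((p : ℝ) ^ (-(1 + t)) - 1 / (p : ℝ) ^ 2) +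
        (k * Z + k * (4 * (ε * Real.log 2))) := by
    have h5 : ∑ p ∈ 𝒢, 1 / (p : ℝ) ^ 2 ≤ Z := hz.sum_le_tsum _ fun n _ => by positivity
    have h6 : ∑ p ∈ 𝒢, Real.log p / p ≤ 2 * Real.log n := by
      refine le_trans ?_ (sum_log_prime_div_le n)
      refine Finset.sum_le_sum_of_subset_of_nonneg ?_ fun p _ _ =>
        div_nonneg (Real.log_natCast_nonneg p) (Nat.cast_nonneg p)
      exact (Finset.filter_subset _ _).trans (Finset.filter_subset _ _)
    have h7 : ∑ p ∈ 𝒢, (k : ℝ) / p ≤ ∑ p ∈ 𝒢, ((k : ℝ) * ((p : ℝ) ^ (-(1 + t)) -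
        1 / (p : ℝ) ^ 2) + (k * (1 / (p : ℝ) ^ 2) + k * t * (Real.log p / p))) := by
      refine Finset.sum_le_sum fun p hp => ?_
      have hp1 : (1 : ℝ) ≤ p := by
        exact_mod_cast (h𝒮p p (Finset.mem_filter.mp hp).1).one_le
      have h8 := mul_le_mul_of_nonneg_left (inv_sub_rpow_le (t := t) hp1) hkR.le
      have h9 : (k : ℝ) / p = k * (1 / p) := by ring
      rw [h9]
      linarith
    refine h7.trans ?_
    rw [Finset.sum_add_distrib, Finset.sum_add_distrib, ← Finset.mul_sum 𝒢 (fun p : ℕ =>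
      1 / (p : ℝ) ^ 2), ← Finset.mul_sum 𝒢 (fun p : ℕ => Real.log p / p)]
    have h8 : (k : ℝ) * t * ∑ p ∈ 𝒢, Real.log p / p ≤ k * (4 * (ε * Real.log 2)) := by
      calc _ ≤ k * t * (2 * Real.log n) := by gcongr
        _ = k * (t * (2 * Real.log n)) := by ring
        _ ≤ k * (4 * (ε * Real.log 2)) := by gcongr
    linarith [mul_le_mul_of_nonneg_left h5 hkR.le]
  rw [← Finset.sum_filter_add_sum_filter_not 𝒮 (· ∣ D)]
  calc _ ≤ Real.exp (∑ p ∈ 𝒢, (k : ℝ) * ((p : ℝ) ^ (-(1 + t)) - 1 / (p : ℝ) ^ 2) +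
        (k * Z + k * (4 * (ε * Real.log 2)) + k * D)) := Real.exp_le_exp.mpr (by linarith)
    _ ≤ B / t * Real.exp (k * Z + k * (4 * (ε * Real.log 2)) + k * D) := by
        rw [Real.exp_add]
        gcongr
    _ = _ := by
        rw [ht]
        field_simp

end

end NormFormSum

/-! ### Assembly. -/

namespace NormFormSum

theorem exists_mul_rpow_le_add_one_pow (A C : ℝ) (k : ℕ) : ∃ J : ℕ, (k : ℝ) ≤ 2 ^ J ∧
    ∀ α : ℕ, 1 ≤ α → A * (α : ℝ) ^ C ≤ ((α : ℝ) + 1) ^ J := by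
  obtain ⟨J₁, hJ₁⟩ := pow_unbounded_of_one_lt |A| (one_lt_two)
  obtain ⟨J₂, hJ₂⟩ := exists_nat_ge C
  refine ⟨J₁ + J₂ + k, ?_, fun α hα => ?_⟩
  · have h1 : (k : ℝ) ≤ 2 ^ k := by exact_mod_cast Nat.lt_two_pow_self.le
    exact h1.trans (pow_le_pow_right₀ one_le_two (Nat.le_add_left _ _))
  · have hα1 : (1 : ℝ) ≤ α := by exact_mod_cast hα
    calc A * (α : ℝ) ^ C ≤ |A| * (α : ℝ) ^ C := by gcongr; exact le_abs_self A
      _ ≤ 2 ^ J₁ * (α : ℝ) ^ (J₂ : ℝ) := by gcongr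
      _ = 2 ^ J₁ * (α : ℝ) ^ J₂ := by rw [Real.rpow_natCast]
      _ ≤ ((α : ℝ) + 1) ^ J₁ * ((α : ℝ) + 1) ^ J₂ := by
          gcongr
          · linarith
          · linarith
      _ = ((α : ℝ) + 1) ^ (J₁ + J₂) := (pow_add _ _ _).symm
      _ ≤ ((α : ℝ) + 1) ^ (J₁ + J₂ + k) :=
          pow_le_pow_right₀ (by linarith) (Nat.le_add_right _ _)

open Classical in
theorem exists_sum_majorant_incompleteNorm_le {K : Type*} [Field K] [NumberField K]
    [IsGalois ℚ K] {k J : ℕ} (hk : 3 ≤ k) (hdeg : Module.finrank ℚ K = k)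
    (ω : Module.Basis (Fin k) ℤ (𝓞 K)) {i₀ : Fin (k - 1)}
    (hω : ω (Fin.castLE (Nat.sub_le k 1) i₀) = 1) (hJ : (k : ℝ) ≤ 2 ^ J) :
    ∃ D : ℝ, ∀ V : ℝ, 2 ≤ V → ∑ v ∈ nonzeroBall (k - 1) V,
      majorant (fun p => if LiesBelowDegreeOne K p then (k : ℝ) else 1) J (incompleteNorm ω v) ≤
        D * (V ^ (k - 1) * Real.log V ^ (k - 1)) := by
  have hk1 : (1 : ℝ) ≤ k := by exact_mod_cast (by omega : 1 ≤ k)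
  obtain ⟨M, hM, hsq⟩ := exists_dvdDensity_prime_pow_le_sq ω hω hk hdeg
  obtain ⟨κ, hκ, hball⟩ := exists_incompleteNorm_le ω hdeg hk
  obtain ⟨C, hC, hmean⟩ := exists_exp_sum_liesBelowDegreeOne_le ω hk hdeg
  -- M + k dominates the constants of both prime power bounds, and γ is a quarter of the decay
  -- exponent 1/k, as the interpolation requires.
  refine exists_sum_majorant_le (K := k) (M := M + k) (γ := 1 / k / 4) (κ := κ)
    (C₀ := C ^ (k - 1)) _ _ (incompleteNorm_dvdPeriodic ω hω) (fun p => ?_) (fun p => ?_)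
    (fun p => ?_) (by positivity) (by positivity) hκ
    (fun p hp => dvdDensity_prime_le ω hω hdeg hp) (fun p α hp hα => ?_) hball
    (fun V hV n hn => ?_)
  · split_ifs
    · exact hk1
    · exact le_rfl
  · split_ifs
    · exact le_rfl
    · exact hk1
  · split_ifs
    · exact hJ
    · exact hk1.trans hJ
  · have hp0 : (0 : ℝ) < p := by exact_mod_cast hp.pos
    refine interpolate_prime_pow_bound (κ := 1 / k) (by positivity) (dvdDensity_nonneg _ _) hp0
      (by ring) ?_ ?_
    · refine (hsq p α hp hα).trans ?_
      gcongr
      linarith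
    · refine (dvdDensity_prime_pow_le_rpow ω hω (by omega) hdeg hp α).trans ?_
      gcongr
      linarith
  · have h1 : ∑ p ∈ n.primesBelow, ((if LiesBelowDegreeOne K p then (k : ℝ) else 1) - 1) *
        dvdDensity (incompleteNorm ω) p ≤
        ((k - 1 : ℕ) : ℝ) * ∑ p ∈ n.primesBelow.filter (LiesBelowDegreeOne K), (k : ℝ) / p := by
      rw [Finset.sum_filter, Finset.mul_sum]
      refine Finset.sum_le_sum fun p hp => ?_
      have hpp := (Nat.mem_primesBelow.mp hp).2
      split_ifs
      · rw [Nat.cast_sub (by omega), Nat.cast_one]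
        exact mul_le_mul_of_nonneg_left (dvdDensity_prime_le ω hω hdeg hpp) (by linarith)
      · simp
    calc _ ≤ Real.exp (((k - 1 : ℕ) : ℝ) *
          ∑ p ∈ n.primesBelow.filter (LiesBelowDegreeOne K), (k : ℝ) / p) :=
          Real.exp_le_exp.mpr h1
      _ ≤ (C * Real.log V) ^ (k - 1) := by
          rw [Real.exp_nat_mul]
          exact pow_le_pow_left₀ (Real.exp_pos _).le (hmean V hV n hn) _
      _ = _ := mul_pow _ _ _

end NormFormSum

theorem mainTheorem2 (K : Type*) [Field K] [NumberField K] [IsGalois ℚ K]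
    (k : ℕ) (hk : 3 ≤ k) (hdeg : Module.finrank ℚ K = k)
    (ω : Module.Basis (Fin k) ℤ (𝓞 K)) (hω : ω ⟨0, by omega⟩ = 1)
    (C : ℝ) (hC : 0 < C) (A : ℝ) :
    ∃ D : ℝ, ∀ F : ArithmeticFunction ℝ, F.IsMultiplicative →
      (∀ p α : ℕ, p.Prime → 1 ≤ α → 0 ≤ F (p ^ α) ∧ F (p ^ α) ≤ A * (α : ℝ) ^ C) →
      (∀ p : ℕ, p.Prime → LiesBelowDegreeOne K p → F p = k) →
      (∀ p : ℕ, p.Prime → ¬ LiesBelowDegreeOne K p → F p = 0) →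
      ∀ V : ℝ, 2 ≤ V →
        ∑ v ∈ nonzeroBall (k - 1) V, F (incompleteNorm ω v) ≤
          D * (V ^ (k - 1) * Real.log V ^ (k - 1)) := by
  classical
  obtain ⟨J, hJ, hAJ⟩ := NormFormSum.exists_mul_rpow_le_add_one_pow A C k
  obtain ⟨D, hD⟩ := NormFormSum.exists_sum_majorant_incompleteNorm_le hk hdeg ω
    (i₀ := ⟨0, by omega⟩) hω hJ
  refine ⟨D, fun F hF hFA hF1 hF0 V hV => (Finset.sum_le_sum fun v _ => ?_).trans (hD V hV)⟩
  refine NormFormSum.IsMultiplicative.le_of_prime_pow hF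
    NormFormSum.majorant_isMultiplicative (fun p α hp hα => (hFA p α hp hα).1)
    (fun p α hp hα => ?_) _
  rw [NormFormSum.majorant_prime_pow hp, if_neg (by omega)]
  -- The exact value at primes must be kept, since it alone determines the power of log V; at higher
  -- powers the crude bound is harmless.
  by_cases hα1 : α = 1
  · rw [if_pos hα1, hα1, pow_one]
    split_ifs with h
    · exact (hF1 p hp h).le
    · rw [hF0 p hp h]
      exact zero_le_one
  · rw [if_neg hα1]
    exact (hFA p α hp hα).2.trans (hAJ α hα)
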